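/- Let $G$ be the set of all functions $a:\mathbb R\to\mathbb C$ of the form $$a(t)=\sum_{j} a_j e^{i\delta_j t}+\int_{-\infty}^{\infty}k(s)e^{its}\,ds,\qquad \sum_j|a_j|<\infty,\quad k\in L^1(\mathbb R),$$ with countably many pairwise distinct $\delta_j\in\mathbb R$. Let $G^+$ (respectively $G^-$) be the set of those $a\in G$ that have such a representation in which all $\delta_j\ge 0$ and $k=0$ on $(-\infty,0)$ (respectively all $\delta_j\le 0$ and $k=0$ on $(0,\infty)$). Write $\widetilde f(t)=f(-t)$ and $\chi(t)=\frac{t-i}{t+i}$; $f^{-1}$ denotes the pointwise reciprocal. If $a=b+h\in G$ is invertible in $G$, where $b$ is the almost periodic part (the sum) and $h$ is the Fourier integral, put $$\nu(a)=\lim_{l\to\infty}\frac1{2l}\,[\arg b(t)]_{-l}^{l},\qquad n(a)=\frac1{2\pi}\,[\arg(1+b^{-1}(t)h(t))]_{t=-\infty}^{\infty},$$ the increments being those of a continuous argument. Theorem. Let $g\in G$ satisfy $g\,\widetilde g=1$. Then $\nu=\nu(g)\in\mathbb R$ and $n=n(g)\in\mathbb Z$ are well defined, and $\xi(g):=(-1)^{n}g(0)$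 equals $1$ or $-1$. The function $g$ admits a Wiener--Hopf factorization $$g(t)=g_-(t)\,e^{i\nu t}\,\chi(t)^n\,g_+(t),\quad t\in\mathbb R,\qquad g_-^{\pm1}\in G^-,\quad g_+^{\pm1}\in G^+,$$ which is unique under the normalization $g_-(0)=1$; and in every such factorization (normalized or not) one has $\widetilde g_+^{\,\pm1}\in G^-$ and $g_-=\xi(g)\,\widetilde g_+^{\,-1}$, that is, $$g(t)=\bigl(\xi(g)\,\widetilde g_+^{\,-1}(t)\bigr)\,e^{i\nu t}\,\chi(t)^n\,g_+(t),\quad t\in\mathbb R.$$ -/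

import Mathlib

namespace WienerHopf

open Filter Topology MeasureTheory

/-- The almost periodic sum `t ↦ ∑_δ c(δ) e^{iδt}`. The frequencies are all real numbers, so they
are pairwise distinct; for absolutely summable `c` only countably many coefficients are nonzero. -/
noncomputable def apSum (c : ℝ → ℂ) (t : ℝ) : ℂ :=
  ∑' δ : ℝ, c δ * Complex.exp (Complex.I * (δ : ℂ) * (t : ℂ))

/-- The Fourier transform `t ↦ ∫ k(s) e^{its} ds`. -/
noncomputable def fourierInt (k : ℝ → ℂ) (t : ℝ) : ℂ :=
  ∫ s : ℝ, k s * Complex.exp (Complex.I * (s : ℂ) * (t : ℂ))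

/-- Almost periodic functions with absolutely convergent Fourier series. -/
def APw : Set (ℝ → ℂ) :=
  {b | ∃ c : ℝ → ℂ, Summable (fun δ => ‖c δ‖) ∧ b = apSum c}

/-- Fourier transforms of `L¹` functions. -/
def L0 : Set (ℝ → ℂ) :=
  {f | ∃ k : ℝ → ℂ, Integrable k ∧ f = fourierInt k}

/-- The algebra `G`. -/
def G : Set (ℝ → ℂ) :=
  {a | ∃ c k : ℝ → ℂ, Summable (fun δ => ‖c δ‖) ∧ Integrable k ∧
    a = apSum c + fourierInt k}

/-- The subalgebra `G⁺`: nonnegative frequencies and `k = 0` on the negative semi-axis. -/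
def Gplus : Set (ℝ → ℂ) :=
  {a | ∃ c k : ℝ → ℂ, Summable (fun δ => ‖c δ‖) ∧ Integrable k ∧
    (∀ δ < 0, c δ = 0) ∧ (∀ s < 0, k s = 0) ∧ a = apSum c + fourierInt k}

/-- The subalgebra `G⁻`: nonpositive frequencies and `k = 0` on the positive semi-axis. -/
def Gminus : Set (ℝ → ℂ) :=
  {a | ∃ c k : ℝ → ℂ, Summable (fun δ => ‖c δ‖) ∧ Integrable k ∧
    (∀ δ > 0, c δ = 0) ∧ (∀ s > 0, k s = 0) ∧ a = apSum c + fourierInt k}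

/-- `f` and its (genuine) pointwise inverse both belong to `S`. -/
def InvertibleIn (S : Set (ℝ → ℂ)) (f : ℝ → ℂ) : Prop :=
  (∀ t, f t ≠ 0) ∧ f ∈ S ∧ f⁻¹ ∈ S

/-- The reflection `f̃(t) = f(-t)`. -/
def tilde (f : ℝ → ℂ) : ℝ → ℂ := fun t => f (-t)

/-- `χ(t) = (t - i)/(t + i)`. -/
noncomputable def chi (t : ℝ) : ℂ := ((t : ℂ) - Complex.I) / ((t : ℂ) + Complex.I)

/-- `θ` is a continuous branch of the argument of the nowhere vanishing function `f`. -/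
def IsContArg (f : ℝ → ℂ) (θ : ℝ → ℝ) : Prop :=
  Continuous θ ∧ ∀ t, f t ≠ 0 ∧ f t = (‖f t‖ : ℂ) * Complex.exp (Complex.I * (θ t : ℂ))

/-- `x = lim_{l → ∞} (1/(2l)) [arg b(t)]_{-l}^{l}`, where `a = b + k`, `b ∈ APw`, `k ∈ L0`. -/
def IsNu (a : ℝ → ℂ) (x : ℝ) : Prop :=
  ∃ b ∈ APw, ∃ k ∈ L0, a = b + k ∧ InvertibleIn APw b ∧ ∃ θ : ℝ → ℝ, IsContArg b θ ∧
    Tendsto (fun l : ℝ => (θ l - θ (-l)) / (2 * l)) atTop (𝓝 x)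

/-- `m = (1/(2π)) [arg (1 + b⁻¹(t) k(t))]_{t = -∞}^{∞}`, where `a = b + k`, `b ∈ APw`,
`k ∈ L0`. -/
def IsN (a : ℝ → ℂ) (m : ℤ) : Prop :=
  ∃ b ∈ APw, ∃ k ∈ L0, a = b + k ∧ InvertibleIn APw b ∧
    ∃ θ : ℝ → ℝ, IsContArg (1 + b⁻¹ * k) θ ∧
      ∃ A B : ℝ, Tendsto θ atTop (𝓝 A) ∧ Tendsto θ atBot (𝓝 B) ∧
        A - B = 2 * Real.pi * (m : ℝ)

/-- The number `ν(a)`. -/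
noncomputable def nu (a : ℝ → ℂ) : ℝ := Classical.epsilon (IsNu a)

/-- The integer `n(a)`. -/
noncomputable def ind (a : ℝ → ℂ) : ℤ := Classical.epsilon (IsN a)

/-- `ξ(g) = (-1)^{n(g)} g(0)`. -/
noncomputable def xi (g : ℝ → ℂ) : ℂ := (-1 : ℂ) ^ ind g * g 0

/-- `g = g₋ e^{iνt} χⁿ g₊` with `ν = ν(g)`, `n = n(g)`, `g₋^{±1} ∈ G⁻`, `g₊^{±1} ∈ G⁺`. -/
def IsWHFactorization (g gm gp : ℝ → ℂ) : Prop :=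
  InvertibleIn Gminus gm ∧ InvertibleIn Gplus gp ∧
    ∀ t : ℝ, g t =
      gm t * Complex.exp (Complex.I * (nu g : ℂ) * (t : ℂ)) * chi t ^ ind g * gp t

end WienerHopf

/-!
A function of `G` is determined by a summable family of coefficients `c` and an integrable density
`k`, and determines them in turn (`coeff_eq_zero`, `density_ae_eq_zero`: integrate against test
functions). So `G` is a commutative Banach algebra `GAlg`, namely `ℓ¹(ℝ) ⊕ L¹(ℝ)` under
convolution, whose characters `eval t` are the evaluations; the ring axioms hold because they hold
after evaluation. The relation `g g̃ = 1` says that `g` is invertible in `G`, with inverse `g̃`.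

Everything rests on the representation `g = e^{iνt} χⁿ e^{f}` with `f ∈ G` (`exists_log`). As the
range of the exponential contains a neighbourhood of `1`, it is enough to know this for a dense
set of invertible elements (`exists_eq_mul_exp_of_mem_closure`).

* For the almost periodic part, take an almost periodic polynomial `p`. Its frequencies generate a
  lattice. The partial logarithmic derivatives of `p` in the lattice coordinates are compatible, and
  dividing their coefficients by nonzero integral coordinates gives an absolutely summable common
  primitive `L`; all partial logarithmic derivatives of `p e^{-L}` are constant, so it is a multiple
  of a single `e^{iνt}` (`apPart_eq_freq_mul_exp_of_finite_support`).
* Dividing by the almost periodic part leaves `1 + k` with `k` a Fourier integral. By Weierstrass'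
  theorem in the variable `e^{-s}`, such elements are approximated by rational functions without real
  zeros or poles. These split into linear factors `(t - z) / (t + i)`, and each factor is an
  exponential, or `χ` times one, because `z` can be moved to `-i` or `i` through invertible elements
  (`exists_exp_eq_div`, `isChiExp_of_mul_eq_one`).

The representation exhibits a continuous argument, so that `ν` and `n` are the mean motion and the
index (`isNu_iff`, `isN_iff`). Splitting `f = f₋ + f₊` according to the sign of the spectrum gives
the factorization with `g₋ = e^{f₋}` and `g₊ = e^{f₊}`. Uniqueness holds since `G⁻ ∩ G⁺` consists of
the constants. Finally, if `g = g₋ e^{iνt} χⁿ g₊`, then `g g̃ = 1` gives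
`g₋ g̃₊ = (g₊ g̃₋)⁻¹ ∈ G⁻ ∩ G⁺`, so `g₋ g̃₊` is a constant, which evaluation at `0` identifies as
`(-1)ⁿ g(0)`.
-/

namespace WienerHopf

open Filter Topology MeasureTheory
open scoped ENNReal SchwartzMap FourierTransform ContDiff

/-! ### Absolutely summable families on the line -/

/-- Absolutely summable families of complex numbers indexed by the real line. -/
noncomputable abbrev EllOne : Type := lp (fun _ : ℝ => ℂ) 1

lemma EllOne.summable_norm (c : EllOne) : Summable fun x => ‖c x‖ := by
  simpa using (lp.memℓp c).summable (by simp)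

lemma EllOne.norm_eq (c : EllOne) : ‖c‖ = ∑' x, ‖c x‖ := by
  have h := lp.norm_eq_tsum_rpow (p := 1) (by simp) c
  simpa using h

/-- The element of `ℓ¹` with given coefficients. -/
def EllOne.of (c : ℝ → ℂ) (hc : Summable fun x => ‖c x‖) : EllOne :=
  ⟨c, memℓp_gen (by simpa using hc)⟩

@[simp] lemma EllOne.of_apply (c : ℝ → ℂ) (hc : Summable fun x => ‖c x‖) (x : ℝ) :
    EllOne.of c hc x = c x := rfl

section WeightedSum

variable {E : Type*} [NormedAddCommGroup E] [NormedSpace ℂ E]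

/-- The weighted sum `∑ c(x) v(x)` of a family of vectors, with coefficients in `ℓ¹`. -/
noncomputable def weightedSum (v : ℝ → E) (c : EllOne) : E := ∑' x, c x • v x

lemma summable_weightedSum [CompleteSpace E] {v : ℝ → E} {M : ℝ} (hv : ∀ x, ‖v x‖ ≤ M)
    (c : EllOne) : Summable fun x => c x • v x := by
  refine Summable.of_norm_bounded (c.summable_norm.mul_right M) fun x => ?_
  rw [norm_smul]
  exact mul_le_mul_of_nonneg_left (hv x) (norm_nonneg _)

lemma norm_weightedSum_le {v : ℝ → E} {M : ℝ} (hv : ∀ x, ‖v x‖ ≤ M) (c : EllOne) :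
    ‖weightedSum v c‖ ≤ ‖c‖ * M := by
  have h1 : ∀ x, ‖c x • v x‖ ≤ ‖c x‖ * M := fun x => by
    rw [norm_smul]
    exact mul_le_mul_of_nonneg_left (hv x) (norm_nonneg _)
  rw [c.norm_eq, ← tsum_mul_right]
  exact tsum_of_norm_bounded (c.summable_norm.mul_right M).hasSum h1

lemma map_weightedSum [CompleteSpace E] {E' : Type*} [NormedAddCommGroup E'] [NormedSpace ℂ E']
    (T : E →L[ℂ] E') {v : ℝ → E} {M : ℝ} (hv : ∀ x, ‖v x‖ ≤ M) (c : EllOne) :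
    T (weightedSum v c) = ∑' x, c x • T (v x) := by
  rw [weightedSum, T.map_tsum (summable_weightedSum hv c)]
  simp

end WeightedSum

lemma norm_exp_I_mul_mul (x t : ℝ) : ‖Complex.exp (Complex.I * (x : ℂ) * (t : ℂ))‖ = 1 := by
  rw [Complex.norm_exp]
  simp

lemma exp_I_add_mul (x y t : ℝ) : Complex.exp (Complex.I * ((x + y : ℝ) : ℂ) * (t : ℂ)) =
    Complex.exp (Complex.I * (x : ℂ) * (t : ℂ)) * Complex.exp (Complex.I * (y : ℂ) * (t : ℂ)) := by
  rw [← Complex.exp_add]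
  push_cast
  ring_nf

/-- Evaluation at `t` of the almost periodic sum, as a functional on `ℓ¹`. -/
noncomputable def evalSum (t : ℝ) : EllOne →L[ℂ] ℂ :=
  LinearMap.mkContinuous
    { toFun := fun c => apSum c t
      map_add' := fun c d => by
        have hv := fun x => (norm_exp_I_mul_mul x t).le
        simp only [apSum, lp.coeFn_add, Pi.add_apply, add_mul]
        exact (summable_weightedSum hv c).tsum_add (summable_weightedSum hv d)
      map_smul' := fun z c => by
        simp only [apSum, lp.coeFn_smul, Pi.smul_apply, smul_eq_mul, mul_assoc, tsum_mul_left,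
          RingHom.id_apply] } 1
    (fun c => by
      have := norm_weightedSum_le (fun x => (norm_exp_I_mul_mul x t).le) c
      rw [mul_one] at this
      rw [one_mul]
      exact this)

@[simp] lemma evalSum_apply (t : ℝ) (c : EllOne) : evalSum t c = apSum c t := rfl

/-- Translation on `ℓ¹`. -/
noncomputable def EllOne.shift (x : ℝ) (c : EllOne) : EllOne :=
  EllOne.of (fun y => c (y - x)) ((Equiv.subRight x).summable_iff.2 c.summable_norm)

@[simp] lemma EllOne.shift_apply (x : ℝ) (c : EllOne) (y : ℝ) : c.shift x y = c (y - x) := rfl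

lemma EllOne.norm_shift (x : ℝ) (c : EllOne) : ‖c.shift x‖ = ‖c‖ := by
  rw [EllOne.norm_eq, EllOne.norm_eq]
  exact (Equiv.subRight x).tsum_eq fun y => ‖c y‖

lemma apSum_shift (x : ℝ) (c : EllOne) (t : ℝ) :
    apSum (c.shift x) t = Complex.exp (Complex.I * (x : ℂ) * (t : ℂ)) * apSum c t := by
  unfold apSum
  rw [← tsum_mul_left, ← (Equiv.addRight x).tsum_eq]
  refine tsum_congr fun y => ?_
  simp only [Equiv.coe_addRight, EllOne.shift_apply, add_sub_cancel_right, exp_I_add_mul]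
  ring

/-- Evaluation of coefficients, as a functional on `ℓ¹`. -/
noncomputable def coeffCLM (x : ℝ) : EllOne →L[ℂ] ℂ :=
  LinearMap.mkContinuous
    { toFun := fun c => c x
      map_add' := fun _ _ => rfl
      map_smul' := fun _ _ => rfl } 1
    (fun c => by
      rw [one_mul]
      exact lp.norm_apply_le_norm one_ne_zero c x)

@[simp] lemma coeffCLM_apply (x : ℝ) (c : EllOne) : coeffCLM x c = c x := rfl

/-! ### Integrable densities on the line -/

/-- Integrable densities on the line. -/
noncomputable abbrev LOne : Type := ℝ →₁[(volume : Measure ℝ)] ℂ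

lemma integrable_mul_exp {k : ℝ → ℂ} (hk : Integrable k) (t : ℝ) :
    Integrable fun s : ℝ => k s * Complex.exp (Complex.I * (s : ℂ) * (t : ℂ)) := by
  refine hk.mul_bdd (c := 1) (Continuous.aestronglyMeasurable (by fun_prop)) ?_
  exact Eventually.of_forall fun s => (norm_exp_I_mul_mul s t).le

lemma fourierInt_congr {k l : ℝ → ℂ} (h : k =ᵐ[volume] l) : fourierInt k = fourierInt l := by
  funext t
  refine integral_congr_ae ?_
  filter_upwards [h] with s hs
  rw [hs]

lemma norm_fourierInt_le (k : ℝ → ℂ) (t : ℝ) : ‖fourierInt k t‖ ≤ ∫ s, ‖k s‖ := by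
  refine (norm_integral_le_integral_norm _).trans_eq ?_
  simp [norm_exp_I_mul_mul]

/-- Evaluation at `t` of the Fourier transform, as a functional on `L¹`. -/
noncomputable def evalInt (t : ℝ) : LOne →L[ℂ] ℂ :=
  LinearMap.mkContinuous
    { toFun := fun k => fourierInt k t
      map_add' := fun k l => by
        rw [fourierInt_congr (Lp.coeFn_add k l)]
        simp only [fourierInt, Pi.add_apply, add_mul]
        exact integral_add (integrable_mul_exp (L1.integrable_coeFn k) t)
          (integrable_mul_exp (L1.integrable_coeFn l) t)
      map_smul' := fun z k => by
        rw [fourierInt_congr (Lp.coeFn_smul z k)]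
        simp only [fourierInt, Pi.smul_apply, smul_eq_mul, mul_assoc, RingHom.id_apply]
        exact integral_const_mul _ _ } 1
    (fun k => by
      rw [one_mul, L1.norm_eq_integral_norm]
      exact norm_fourierInt_le _ t)

@[simp] lemma evalInt_apply (t : ℝ) (k : LOne) : evalInt t k = fourierInt k t := rfl

/-- Translation on `L¹`. -/
noncomputable def LOne.shift (x : ℝ) : LOne →ₗᵢ[ℂ] LOne :=
  Lp.compMeasurePreservingₗᵢ ℂ (fun s => s - x) (measurePreserving_sub_right volume x)

lemma LOne.coeFn_shift (x : ℝ) (k : LOne) :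
    (LOne.shift x k : ℝ → ℂ) =ᵐ[volume] fun s => k (s - x) :=
  Lp.coeFn_compMeasurePreserving k (measurePreserving_sub_right volume x)

lemma fourierInt_shift (x : ℝ) (k : LOne) (t : ℝ) :
    fourierInt (LOne.shift x k) t =
      Complex.exp (Complex.I * (x : ℂ) * (t : ℂ)) * fourierInt k t := by
  rw [fourierInt_congr (LOne.coeFn_shift x k)]
  unfold fourierInt
  rw [← integral_const_mul, ← integral_add_right_eq_self _ x]
  refine integral_congr_ae (Eventually.of_forall fun s => ?_)
  simp only [add_sub_cancel_right, exp_I_add_mul]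
  ring

/-- Convolution on `L¹`, at the level of functions. -/
noncomputable def conv (k l : ℝ → ℂ) : ℝ → ℂ :=
  convolution k l (ContinuousLinearMap.mul ℂ ℂ) volume

lemma conv_apply (k l : ℝ → ℂ) (s : ℝ) : conv k l s = ∫ x, k x * l (s - x) := rfl

lemma integrable_conv {k l : ℝ → ℂ} (hk : Integrable k) (hl : Integrable l) :
    Integrable (conv k l) := hk.integrable_convolution _ hl

lemma fourierInt_conv {k l : ℝ → ℂ} (hk : Integrable k) (hl : Integrable l) (t : ℝ) :
    fourierInt (conv k l) t = fourierInt k t * fourierInt l t := by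
  have h := integral_convolution (ContinuousLinearMap.mul ℂ ℂ) (integrable_mul_exp hk t)
    (integrable_mul_exp hl t) (μ := volume) (ν := volume)
  rw [ContinuousLinearMap.mul_apply'] at h
  unfold fourierInt
  rw [← h]
  refine integral_congr_ae (Eventually.of_forall fun s => ?_)
  simp only [conv_apply]
  rw [← integral_mul_const]
  refine integral_congr_ae (Eventually.of_forall fun x => ?_)
  have : Complex.exp (Complex.I * (s : ℂ) * (t : ℂ)) =
      Complex.exp (Complex.I * (x : ℂ) * (t : ℂ)) *
        Complex.exp (Complex.I * ((s - x : ℝ) : ℂ) * (t : ℂ)) := by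
    rw [← exp_I_add_mul]
    simp
  simp only [ContinuousLinearMap.mul_apply', this]
  ring

lemma integral_norm_conv_le {k l : ℝ → ℂ} (hk : Integrable k) (hl : Integrable l) :
    ∫ s, ‖conv k l s‖ ≤ (∫ s, ‖k s‖) * ∫ s, ‖l s‖ := by
  have h := integral_convolution (ContinuousLinearMap.mul ℝ ℝ) hk.norm hl.norm
    (μ := volume) (ν := volume)
  rw [ContinuousLinearMap.mul_apply'] at h
  rw [← h]
  refine integral_mono (integrable_conv hk hl).norm
    (hk.norm.integrable_convolution _ hl.norm) fun s => ?_
  refine (norm_integral_le_integral_norm _).trans_eq ?_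
  simp only [ContinuousLinearMap.mul_apply', norm_mul]
  rfl

/-! ### Uniqueness of the spectral data -/

lemma continuous_apSum (c : EllOne) : Continuous (apSum c) := by
  refine continuous_tsum (fun x => by fun_prop) c.summable_norm fun x t => ?_
  rw [norm_mul, norm_exp_I_mul_mul, mul_one]

lemma norm_apSum_le (c : EllOne) (t : ℝ) : ‖apSum c t‖ ≤ ‖c‖ := by
  have := norm_weightedSum_le (fun x => (norm_exp_I_mul_mul x t).le) c
  rwa [mul_one] at this

lemma continuous_fourierInt {k : ℝ → ℂ} (hk : Integrable k) : Continuous (fourierInt k) := by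
  refine continuous_of_dominated (bound := fun s => ‖k s‖)
    (fun t => (integrable_mul_exp hk t).aestronglyMeasurable) (fun t => ?_) hk.norm ?_
  · exact Eventually.of_forall fun s => by rw [norm_mul, norm_exp_I_mul_mul, mul_one]
  · exact Eventually.of_forall fun s => by fun_prop

lemma EllOne.hasSum_single (c : EllOne) :
    HasSum (fun x => c x • (lp.single 1 x (1 : ℂ) : EllOne)) c := by
  have h := lp.hasSum_single (by simp) c
  simpa only [← lp.single_smul, smul_eq_mul, mul_one] using h

lemma apSum_single (x : ℝ) (z : ℂ) (t : ℝ) :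
    apSum (lp.single 1 x z : EllOne) t = z * Complex.exp (Complex.I * (x : ℂ) * (t : ℂ)) := by
  unfold apSum
  rw [tsum_eq_single x]
  · simp
  · intro y hy
    simp [hy]

/-- Integrating an almost periodic sum against an integrable function. -/
lemma integral_apSum_mul (c : EllOne) {φ : ℝ → ℂ} (hφ : Integrable φ) :
    ∫ t, apSum c t * φ t =
      ∑' x, c x * ∫ t : ℝ, Complex.exp (Complex.I * (x : ℂ) * (t : ℂ)) * φ t := by
  have hint : ∀ c : EllOne, Integrable fun t => apSum c t * φ t := fun c =>
    hφ.bdd_mul (continuous_apSum c).aestronglyMeasurable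
      (Eventually.of_forall (norm_apSum_le c))
  let T : EllOne →L[ℂ] ℂ := LinearMap.mkContinuous
    { toFun := fun c => ∫ t, apSum c t * φ t
      map_add' := fun c d => by
        rw [← integral_add (hint c) (hint d)]
        refine integral_congr_ae (Eventually.of_forall fun t => ?_)
        simp only [← evalSum_apply, map_add, add_mul]
      map_smul' := fun z c => by
        simp only [← evalSum_apply, map_smul, smul_eq_mul, mul_assoc, RingHom.id_apply]
        exact integral_const_mul _ _ } (∫ t, ‖φ t‖)
    (fun c => by
      refine (norm_integral_le_integral_norm _).trans ?_
      rw [← integral_mul_const]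
      refine integral_mono (hint c).norm (hφ.norm.mul_const _) fun t => ?_
      simp only [norm_mul, mul_comm ‖φ t‖]
      exact mul_le_mul_of_nonneg_right (norm_apSum_le c t) (norm_nonneg _))
  have h := (T.hasSum c.hasSum_single).tsum_eq
  change _ = ∫ t, apSum c t * φ t at h
  rw [← h]
  refine tsum_congr fun x => ?_
  rw [map_smul, smul_eq_mul]
  congr 1
  symm
  change _ = T (lp.single 1 x 1)
  change _ = ∫ t, apSum (lp.single 1 x (1 : ℂ) : EllOne) t * φ t
  simp only [apSum_single, one_mul]

lemma integral_fourierInt_mul {k : ℝ → ℂ} (hk : Integrable k) {φ : ℝ → ℂ} (hφ : Integrable φ) :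
    ∫ t, fourierInt k t * φ t =
      ∫ s, k s * ∫ t : ℝ, Complex.exp (Complex.I * (s : ℂ) * (t : ℂ)) * φ t := by
  have hprod : Integrable (Function.uncurry fun (t s : ℝ) =>
      (k s * Complex.exp (Complex.I * (s : ℂ) * (t : ℂ))) * φ t) (volume.prod volume) := by
    have h := (hφ.mul_prod hk).bdd_mul (c := 1)
      (f := fun p : ℝ × ℝ => Complex.exp (Complex.I * (p.2 : ℂ) * (p.1 : ℂ)))
      (Continuous.aestronglyMeasurable (by fun_prop))
      (Eventually.of_forall fun p => (norm_exp_I_mul_mul p.2 p.1).le)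
    refine h.congr (Eventually.of_forall fun p => ?_)
    simp only [Function.uncurry]
    ring
  have h := integral_integral_swap hprod
  simp only [fourierInt, ← integral_mul_const, ← integral_const_mul]
  rw [h]
  refine integral_congr_ae (Eventually.of_forall fun s => ?_)
  refine integral_congr_ae (Eventually.of_forall fun t => ?_)
  simp only
  ring

/-- If `∑ c(δ) e^{iδt} + ∫ k(s) e^{ist} ds` vanishes identically, then the measure
`∑ c(δ) ε_δ + k ds` annihilates all test functions. -/
lemma pairing_eq_zero (c : EllOne) {k : ℝ → ℂ} (hk : Integrable k)
    (h : ∀ t, apSum c t + fourierInt k t = 0) {ψ : ℝ → ℂ} (hψ : ContDiff ℝ ∞ ψ)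
    (hψ' : HasCompactSupport ψ) :
    (∑' x, c x * ψ x) + ∫ s, k s * ψ s = 0 := by
  have h2π : (2 * Real.pi : ℝ) ≠ 0 := by positivity
  let η : 𝓢(ℝ, ℂ) := HasCompactSupport.toSchwartzMap (f := fun u => ψ (u * (2 * Real.pi)))
    (hψ'.comp_homeomorph (Homeomorph.mulRight₀ _ h2π)) (by fun_prop)
  have hη : ∀ s : ℝ, ∫ t : ℝ, Complex.exp (Complex.I * (s : ℂ) * (t : ℂ)) * (𝓕 η) t = ψ s := by
    intro s
    have h1 : (𝓕⁻ (𝓕 η)) (s / (2 * Real.pi)) = ψ s := by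
      rw [FourierTransform.fourierInv_fourier_eq]
      change ψ (s / (2 * Real.pi) * (2 * Real.pi)) = ψ s
      rw [div_mul_cancel₀ _ h2π]
    rw [← h1, SchwartzMap.fourierInv_coe, Real.fourierInv_eq']
    refine integral_congr_ae (Eventually.of_forall fun t => ?_)
    simp only [smul_eq_mul]
    congr 2
    have : (Real.pi : ℂ) ≠ 0 := by exact_mod_cast Real.pi_ne_zero
    simp
    field_simp
  have hint := (𝓕 η).integrable (μ := volume)
  have h1 := integral_apSum_mul c hint
  have h2 := integral_fourierInt_mul hk hint
  simp only [hη] at h1 h2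
  rw [← h1, ← h2, ← integral_add]
  · simp [← add_mul, h]
  · exact hint.bdd_mul (continuous_apSum c).aestronglyMeasurable
      (Eventually.of_forall (norm_apSum_le c))
  · exact hint.bdd_mul (continuous_fourierInt hk).aestronglyMeasurable
      (Eventually.of_forall (norm_fourierInt_le k))

/-- The coefficient at `y` is recovered by test functions shrinking to the indicator of `{y}`. -/
lemma coeff_eq_zero (c : EllOne) {k : ℝ → ℂ} (hk : Integrable k)
    (h : ∀ t, apSum c t + fourierInt k t = 0) (y : ℝ) : c y = 0 := by
  let f : ℕ → ContDiffBump y := fun n => ⟨1 / (2 * (n + 1)), 1 / (n + 1), by positivity, by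
    gcongr; linarith [(n.cast_nonneg : (0:ℝ) ≤ n)]⟩
  have hf0 : ∀ x, x ≠ y → ∀ᶠ n in atTop, f n x = 0 := by
    intro x hx
    have h1 : 0 < dist x y := dist_pos.2 hx
    filter_upwards [tendsto_one_div_add_atTop_nhds_zero_nat.eventually_lt_const h1] with n hn
    exact (f n).zero_of_le_dist hn.le
  have hf1 : ∀ n, f n y = 1 := fun n => (f n).one_of_mem_closedBall (by
    simp only [Metric.mem_closedBall, dist_self]
    exact (f n).rIn_pos.le)
  have hb : ∀ n x, ‖((f n x : ℝ) : ℂ)‖ ≤ 1 := fun n x => by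
    rw [Complex.norm_real, Real.norm_eq_abs, abs_of_nonneg (f n).nonneg]
    exact (f n).le_one
  have hlim1 : Tendsto (fun n => ∑' x, c x * ((f n x : ℝ) : ℂ)) atTop
      (𝓝 (∑' x, if x = y then c y else 0)) := by
    refine tendsto_tsum_of_dominated_convergence c.summable_norm (fun x => ?_)
      (Eventually.of_forall fun n x => ?_)
    · by_cases hx : x = y
      · subst hx
        simp [hf1]
      · simp only [hx, if_false]
        refine tendsto_const_nhds.congr' ?_
        filter_upwards [hf0 x hx] with n hn
        simp [hn]
    · rw [norm_mul]
      exact mul_le_of_le_one_right (norm_nonneg _) (hb n x)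
  have hlim2 : Tendsto (fun n => ∫ s, k s * ((f n s : ℝ) : ℂ)) atTop (𝓝 (∫ s : ℝ, (0 : ℂ))) := by
    refine tendsto_integral_of_dominated_convergence (fun s => ‖k s‖) (fun n => ?_) hk.norm
      (fun n => Eventually.of_forall fun s => ?_) ?_
    · exact hk.aestronglyMeasurable.mul
        (Complex.continuous_ofReal.comp (f n).continuous).aestronglyMeasurable
    · rw [norm_mul]
      exact mul_le_of_le_one_right (norm_nonneg _) (hb n s)
    · filter_upwards [Measure.ae_ne volume y] with s hs
      refine tendsto_const_nhds.congr' ?_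
      filter_upwards [hf0 s hs] with n hn
      simp [hn]
  have h0 : ∀ n, (∑' x, c x * ((f n x : ℝ) : ℂ)) + ∫ s, k s * ((f n s : ℝ) : ℂ) = 0 := fun n =>
    pairing_eq_zero c hk h (Complex.ofRealCLM.contDiff.comp (f n).contDiff)
      ((f n).hasCompactSupport.comp_left Complex.ofReal_zero)
  have hlim := hlim1.add hlim2
  simp only [h0, tsum_ite_eq, integral_zero, add_zero] at hlim
  exact (tendsto_nhds_unique hlim tendsto_const_nhds)

lemma density_ae_eq_zero (c : EllOne) {k : ℝ → ℂ} (hk : Integrable k)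
    (h : ∀ t, apSum c t + fourierInt k t = 0) : k =ᵐ[volume] 0 := by
  have hc : ∀ x, c x = 0 := coeff_eq_zero c hk h
  refine ae_eq_zero_of_integral_contDiff_smul_eq_zero hk.locallyIntegrable fun g hg hg' => ?_
  have := pairing_eq_zero c hk h (Complex.ofRealCLM.contDiff.comp hg)
    (hg'.comp_left Complex.ofReal_zero)
  simp only [hc, zero_mul, tsum_zero, zero_add] at this
  rw [← this]
  refine integral_congr_ae (Eventually.of_forall fun s => ?_)
  simp [mul_comm]

/-! ### The Banach algebra of spectral data -/

/-- The Banach space `ℓ¹(ℝ) ⊕ L¹(ℝ)` with the sum norm. Its elements are the pairs `(c, k)` of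
coefficients and density that represent the functions of `G`; it carries the convolution product
below, so that it is a model of the algebra `G` in which limits can be taken. -/
def GAlg : Type := WithLp 1 (EllOne × LOne)

namespace GAlg

noncomputable instance : NormedAddCommGroup GAlg :=
  inferInstanceAs (NormedAddCommGroup (WithLp 1 (EllOne × LOne)))

noncomputable instance : NormedSpace ℂ GAlg :=
  inferInstanceAs (NormedSpace ℂ (WithLp 1 (EllOne × LOne)))

instance : CompleteSpace GAlg :=
  inferInstanceAs (CompleteSpace (WithLp 1 (EllOne × LOne)))

/-- The pair with coefficients `c` and density `k`. -/
noncomputable def mk (c : EllOne) (k : LOne) : GAlg := WithLp.toLp 1 (c, k)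

/-- The coefficients of the almost periodic part. -/
noncomputable def coeff : GAlg →L[ℂ] EllOne := WithLp.fstL 1 ℂ EllOne LOne

/-- The density of the Fourier integral part. -/
noncomputable def dens : GAlg →L[ℂ] LOne := WithLp.sndL 1 ℂ EllOne LOne

@[simp] lemma coeff_mk (c : EllOne) (k : LOne) : coeff (mk c k) = c := rfl
@[simp] lemma dens_mk (c : EllOne) (k : LOne) : dens (mk c k) = k := rfl

lemma mk_coeff_dens (a : GAlg) : mk (coeff a) (dens a) = a := rfl

lemma ext {a b : GAlg} (h1 : coeff a = coeff b) (h2 : dens a = dens b) : a = b := by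
  rw [← mk_coeff_dens a, ← mk_coeff_dens b, h1, h2]

lemma norm_eq (a : GAlg) : ‖a‖ = ‖coeff a‖ + ‖dens a‖ := WithLp.prod_norm_eq_of_L1 _

/-- The value at `t` of the function with given spectral data. -/
noncomputable def eval (t : ℝ) : GAlg →L[ℂ] ℂ :=
  (evalSum t).comp coeff + (evalInt t).comp dens

lemma eval_eq (t : ℝ) (a : GAlg) : eval t a = apSum (coeff a) t + fourierInt (dens a) t := rfl

lemma eval_mk (t : ℝ) (c : EllOne) (k : LOne) :
    eval t (mk c k) = apSum c t + fourierInt k t := rfl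

lemma continuous_eval (a : GAlg) : Continuous fun t => eval t a :=
  (continuous_apSum _).add (continuous_fourierInt (L1.integrable_coeFn _))

lemma eval_injective {a b : GAlg} (h : ∀ t, eval t a = eval t b) : a = b := by
  rw [← sub_eq_zero]
  have h0 : ∀ t, apSum (coeff (a - b)) t + fourierInt (dens (a - b)) t = 0 := fun t => by
    rw [← eval_eq, map_sub, h, sub_self]
  refine ext ?_ ?_
  · rw [map_zero]
    exact lp.ext (funext fun x => coeff_eq_zero _ (L1.integrable_coeFn _) h0 x)
  · rw [map_zero]
    exact (Lp.eq_zero_iff_ae_eq_zero).2 (density_ae_eq_zero _ (L1.integrable_coeFn _) h0)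

/-- Convolution of coefficients. -/
noncomputable def convSum (c d : EllOne) : EllOne := weightedSum (fun x => d.shift x) c

/-- Convolution of coefficients with a density. -/
noncomputable def convMixed (c : EllOne) (k : LOne) : LOne :=
  weightedSum (fun x => LOne.shift x k) c

/-- Convolution of densities. -/
noncomputable def convInt (k l : LOne) : LOne :=
  (integrable_conv (L1.integrable_coeFn k) (L1.integrable_coeFn l)).toL1 _

lemma convSum_apply (c d : EllOne) (y : ℝ) : convSum c d y = ∑' x, c x * d (y - x) := by
  rw [← coeffCLM_apply, convSum, map_weightedSum _ (fun x => (d.norm_shift x).le)]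
  rfl

lemma norm_convSum_le (c d : EllOne) : ‖convSum c d‖ ≤ ‖c‖ * ‖d‖ :=
  norm_weightedSum_le (fun x => (d.norm_shift x).le) c

lemma norm_convMixed_le (c : EllOne) (k : LOne) : ‖convMixed c k‖ ≤ ‖c‖ * ‖k‖ :=
  norm_weightedSum_le (fun x => ((LOne.shift x).norm_map k).le) c

lemma norm_convInt_le (k l : LOne) : ‖convInt k l‖ ≤ ‖k‖ * ‖l‖ := by
  rw [convInt, L1.norm_of_fun_eq_integral_norm, L1.norm_eq_integral_norm, L1.norm_eq_integral_norm]
  exact integral_norm_conv_le (L1.integrable_coeFn k) (L1.integrable_coeFn l)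

lemma apSum_convSum (c d : EllOne) (t : ℝ) : apSum (convSum c d) t = apSum c t * apSum d t := by
  rw [← evalSum_apply, convSum, map_weightedSum _ (fun x => (d.norm_shift x).le), apSum,
    ← tsum_mul_right]
  simp only [evalSum_apply, apSum_shift, smul_eq_mul, mul_assoc]

lemma fourierInt_convMixed (c : EllOne) (k : LOne) (t : ℝ) :
    fourierInt (convMixed c k) t = apSum c t * fourierInt k t := by
  rw [← evalInt_apply, convMixed, map_weightedSum _ (fun x => ((LOne.shift x).norm_map k).le),
    apSum, ← tsum_mul_right]
  simp only [evalInt_apply, fourierInt_shift, smul_eq_mul, mul_assoc]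

lemma fourierInt_convInt (k l : LOne) (t : ℝ) :
    fourierInt (convInt k l) t = fourierInt k t * fourierInt l t := by
  rw [convInt, fourierInt_congr (Integrable.coeFn_toL1 _),
    fourierInt_conv (L1.integrable_coeFn k) (L1.integrable_coeFn l)]

noncomputable instance : Mul GAlg where
  mul a b := mk (convSum (coeff a) (coeff b))
    (convMixed (coeff a) (dens b) + convMixed (coeff b) (dens a) + convInt (dens a) (dens b))

noncomputable instance : One GAlg where
  one := mk (lp.single 1 0 1) 0

lemma coeff_mul (a b : GAlg) : coeff (a * b) = convSum (coeff a) (coeff b) := rfl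

lemma dens_mul (a b : GAlg) : dens (a * b) =
    convMixed (coeff a) (dens b) + convMixed (coeff b) (dens a) + convInt (dens a) (dens b) := rfl

lemma coeff_one : coeff 1 = lp.single 1 0 1 := rfl

lemma dens_one : dens 1 = 0 := rfl

lemma eval_mul (t : ℝ) (a b : GAlg) : eval t (a * b) = eval t a * eval t b := by
  simp only [eval_eq, coeff_mul, dens_mul, apSum_convSum]
  rw [← evalInt_apply, map_add, map_add]
  simp only [evalInt_apply, fourierInt_convMixed, fourierInt_convInt]
  ring

lemma eval_one (t : ℝ) : eval t 1 = 1 := by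
  rw [eval_eq, coeff_one, dens_one, apSum_single, ← evalInt_apply, map_zero]
  simp

lemma norm_mul_le' (a b : GAlg) : ‖a * b‖ ≤ ‖a‖ * ‖b‖ := by
  rw [norm_eq, norm_eq a, norm_eq b, coeff_mul, dens_mul]
  have h1 := norm_convSum_le (coeff a) (coeff b)
  have h2 := norm_convMixed_le (coeff a) (dens b)
  have h3 := norm_convMixed_le (coeff b) (dens a)
  have h4 := norm_convInt_le (dens a) (dens b)
  have h5 := norm_add₃_le (a := convMixed (coeff a) (dens b))
    (b := convMixed (coeff b) (dens a)) (c := convInt (dens a) (dens b))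
  linarith

-- The ring axioms are inherited from `ℂ` because the functionals `eval t` separate points.
noncomputable instance : NormedCommRing GAlg where
  __ := (inferInstance : NormedAddCommGroup GAlg)
  left_distrib a b c := eval_injective fun t => by simp only [eval_mul, map_add, mul_add]
  right_distrib a b c := eval_injective fun t => by simp only [eval_mul, map_add, add_mul]
  zero_mul a := eval_injective fun t => by simp only [eval_mul, map_zero, zero_mul]
  mul_zero a := eval_injective fun t => by simp only [eval_mul, map_zero, mul_zero]
  mul_assoc a b c := eval_injective fun t => by simp only [eval_mul, mul_assoc]
  one_mul a := eval_injective fun t => by simp only [eval_mul, eval_one, one_mul]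
  mul_one a := eval_injective fun t => by simp only [eval_mul, eval_one, mul_one]
  mul_comm a b := eval_injective fun t => by simp only [eval_mul, mul_comm]
  norm_mul_le := norm_mul_le'

noncomputable instance : Algebra ℂ GAlg :=
  Algebra.ofModule
    (fun z a b => eval_injective fun t => by
      simp only [eval_mul, map_smul, smul_eq_mul, mul_assoc])
    (fun z a b => eval_injective fun t => by
      simp only [eval_mul, map_smul, smul_eq_mul, mul_left_comm])

noncomputable instance : NormedAlgebra ℂ GAlg where
  norm_smul_le z a := norm_smul_le z a

noncomputable instance : NormedAlgebra ℚ GAlg := NormedAlgebra.restrictScalars ℚ ℂ GAlg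

/-- Evaluation at `t` as a character of the algebra. -/
noncomputable def evalHom (t : ℝ) : GAlg →ₐ[ℂ] ℂ :=
  AlgHom.ofLinearMap (eval t : GAlg →ₗ[ℂ] ℂ) (eval_one t) (eval_mul t)

@[simp] lemma evalHom_apply (t : ℝ) (a : GAlg) : evalHom t a = eval t a := rfl

/-- The projection of the algebra onto the almost periodic part. -/
noncomputable def apPart : GAlg →ₐ[ℂ] GAlg where
  toFun a := mk (coeff a) 0
  map_one' := rfl
  map_mul' a b := eval_injective fun t => by
    have h0 : fourierInt ((0 : LOne) : ℝ → ℂ) t = 0 := map_zero (evalInt t)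
    simp only [eval_mul, eval_mk, coeff_mul, apSum_convSum, h0, add_zero]
  map_zero' := rfl
  map_add' a b := by
    refine ext (by simp) ?_
    simp
  commutes' z := by
    rw [Algebra.algebraMap_eq_smul_one]
    refine ext (by simp) ?_
    simp [dens_one]

lemma coeff_apPart (a : GAlg) : coeff (apPart a) = coeff a := rfl

lemma dens_apPart (a : GAlg) : dens (apPart a) = 0 := rfl

lemma continuous_apPart : Continuous apPart := by
  have h : ∀ a, ‖apPart a‖ ≤ 1 * ‖a‖ := fun a => by
    rw [norm_eq, norm_eq a, coeff_apPart, dens_apPart, norm_zero]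
    linarith [norm_nonneg (dens a)]
  exact (LinearMap.mkContinuous (apPart : GAlg →ₐ[ℂ] GAlg).toLinearMap 1 h).continuous

lemma eval_exp (t : ℝ) (a : GAlg) : eval t (NormedSpace.exp a) = Complex.exp (eval t a) := by
  rw [← evalHom_apply, NormedSpace.map_exp (evalHom t) (eval t).continuous, Complex.exp_eq_exp_ℂ]
  rfl

lemma apPart_exp (a : GAlg) : apPart (NormedSpace.exp a) = NormedSpace.exp (apPart a) :=
  NormedSpace.map_exp apPart continuous_apPart a

/-! ### The exponential range -/

/-- The elements with a logarithm, as a subgroup of the group of units. -/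
noncomputable def expSubgroup : Subgroup GAlgˣ where
  carrier := {u | ∃ a, NormedSpace.exp a = (u : GAlg)}
  one_mem' := ⟨0, by simp [NormedSpace.exp_zero]⟩
  mul_mem' := by
    rintro u v ⟨a, ha⟩ ⟨b, hb⟩
    exact ⟨a + b, by rw [NormedSpace.exp_add, ha, hb, Units.val_mul]⟩
  inv_mem' := by
    rintro u ⟨a, ha⟩
    refine ⟨-a, ?_⟩
    rw [eq_comm, Units.inv_eq_of_mul_eq_one_right]
    rw [← ha, ← NormedSpace.exp_add, add_neg_cancel, NormedSpace.exp_zero]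

lemma mem_expSubgroup {u : GAlgˣ} : u ∈ expSubgroup ↔ ∃ a, NormedSpace.exp a = (u : GAlg) :=
  Iff.rfl

/-- By the inverse function theorem, all elements close to `1` have a logarithm. -/
lemma eventually_exists_exp : ∀ᶠ x in 𝓝 (1 : GAlg), ∃ a, NormedSpace.exp a = x := by
  have h := (hasStrictFDerivAt_exp_zero (𝕂 := ℂ) (𝔸 := GAlg)).map_nhds_eq_of_surj
    (LinearMap.range_eq_top.2 fun x => ⟨x, rfl⟩)
  rw [NormedSpace.exp_zero] at h
  rw [← h]
  exact eventually_map.2 (Eventually.of_forall fun a => ⟨a, rfl⟩)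

lemma isOpen_expSubgroup : IsOpen (expSubgroup : Set GAlgˣ) := by
  refine Subgroup.isOpen_of_mem_nhds _ (g := 1) ?_
  exact (Units.continuous_val.tendsto 1).eventually eventually_exists_exp

/-- An invertible element agrees with all sufficiently close elements up to an exponential. -/
lemma exists_eq_mul_exp_of_mem_closure {S : Set GAlg} {a a' : GAlg} (ha : a * a' = 1)
    (hS : a ∈ closure S) : ∃ p ∈ S, ∃ f, a = p * NormedSpace.exp f := by
  have hcont : Tendsto (fun p => a' * p) (𝓝 a) (𝓝 1) := by
    have h := (continuous_const_mul a').tendsto a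
    rwa [mul_comm a' a, ha] at h
  obtain ⟨p, hp, f, hf⟩ := ((mem_closure_iff_frequently.1 hS).and_eventually
    (hcont.eventually eventually_exists_exp)).exists
  refine ⟨p, hp, -f, ?_⟩
  have h1 : p = a * NormedSpace.exp f := by
    rw [hf, ← mul_assoc, ha, one_mul]
  rw [h1, mul_assoc, ← NormedSpace.exp_add, add_neg_cancel, NormedSpace.exp_zero, mul_one]

/-- A segment of invertible elements `1 - s a` starting at `1` stays in the range of the
exponential. -/
lemma exists_exp_eq_one_sub {a : GAlg} (h : ∀ s ∈ Set.Icc (0 : ℝ) 1, IsUnit (1 - (s : ℂ) • a)) :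
    ∃ f, NormedSpace.exp f = 1 - a := by
  choose u hu using fun s : Set.Icc (0 : ℝ) 1 => h s s.2
  have hcont : Continuous u := by
    rw [Units.isOpenEmbedding_val.continuous_iff]
    have : (Units.val ∘ u) = fun s : Set.Icc (0 : ℝ) 1 => 1 - ((s : ℝ) : ℂ) • a := funext hu
    rw [this]
    fun_prop
  have hclopen : IsClopen (u ⁻¹' (expSubgroup : Set GAlgˣ)) :=
    ⟨(expSubgroup.isClosed_of_isOpen isOpen_expSubgroup).preimage hcont,
      isOpen_expSubgroup.preimage hcont⟩
  have h0 : u 0 ∈ expSubgroup := ⟨0, by rw [hu]; simp [NormedSpace.exp_zero]⟩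
  have h1 : (1 : Set.Icc (0 : ℝ) 1) ∈ u ⁻¹' (expSubgroup : Set GAlgˣ) := by
    rw [hclopen.eq_univ ⟨0, h0⟩]
    trivial
  obtain ⟨f, hf⟩ := mem_expSubgroup.1 h1
  refine ⟨f, ?_⟩
  rw [hf, hu]
  simp

/-! ### Subalgebras cut out by the spectrum -/

lemma summable_coeff_mul (a b : GAlg) (y : ℝ) :
    Summable fun x => coeff a x * coeff b (y - x) := by
  refine Summable.of_norm_bounded ((coeff a).summable_norm.mul_right ‖coeff b‖) fun x => ?_
  rw [norm_mul]
  exact mul_le_mul_of_nonneg_left (lp.norm_apply_le_norm one_ne_zero _ _) (norm_nonneg _)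

lemma coeff_mul_apply (a b : GAlg) (y : ℝ) :
    coeff (a * b) y = ∑' x, coeff a x * coeff b (y - x) := convSum_apply _ _ _

lemma coeff_mul_congr {a a' b b' : GAlg} (ha : coeff a = coeff a') (hb : coeff b = coeff b') :
    coeff (a * b) = coeff (a' * b') := by
  rw [coeff_mul, coeff_mul, ha, hb]

lemma coeff_one_apply (x : ℝ) : coeff 1 x = if x = 0 then 1 else 0 := by
  rw [coeff_one, lp.single_apply]
  by_cases h : x = 0
  · subst h; simp
  · simp [h]

lemma coeff_add_apply (a b : GAlg) (x : ℝ) : coeff (a + b) x = coeff a x + coeff b x := by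
  rw [map_add]; rfl

lemma coeff_sub_apply (a b : GAlg) (x : ℝ) : coeff (a - b) x = coeff a x - coeff b x := by
  rw [map_sub]; rfl

lemma coeff_neg_apply (a : GAlg) (x : ℝ) : coeff (-a) x = -coeff a x := by
  rw [map_neg]; rfl

lemma coeff_smul_apply (z : ℂ) (a : GAlg) (x : ℝ) : coeff (z • a) x = z * coeff a x := by
  rw [map_smul]; rfl

/-- The subalgebra of elements all of whose frequencies lie in the monoid `S`. -/
noncomputable def coeffOn (S : AddSubmonoid ℝ) : Subalgebra ℂ GAlg where
  carrier := {a | ∀ x ∉ S, coeff a x = 0}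
  mul_mem' := by
    intro a b ha hb y hy
    rw [coeff_mul_apply]
    refine (tsum_congr fun x => ?_).trans tsum_zero
    by_cases hx : x ∈ S
    · rw [hb (y - x) fun h => hy (by simpa using S.add_mem hx h), mul_zero]
    · rw [ha x hx, zero_mul]
  add_mem' := by
    intro a b ha hb x hx
    rw [coeff_add_apply, ha x hx, hb x hx, add_zero]
  algebraMap_mem' := by
    intro z x hx
    have hx0 : x ≠ 0 := fun h => hx (h ▸ S.zero_mem)
    rw [Algebra.algebraMap_eq_smul_one, coeff_smul_apply, coeff_one_apply, if_neg hx0, mul_zero]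

lemma mem_coeffOn {S : AddSubmonoid ℝ} {a : GAlg} :
    a ∈ coeffOn S ↔ ∀ x ∉ S, coeff a x = 0 := Iff.rfl

lemma isClosed_coeffOn (S : AddSubmonoid ℝ) : IsClosed (coeffOn S : Set GAlg) := by
  have : (coeffOn S : Set GAlg) = ⋂ x, ⋂ (_ : x ∉ S), {a | coeffCLM x (coeff a) = 0} := by
    ext a
    simp [mem_coeffOn]
  rw [this]
  exact isClosed_iInter fun x => isClosed_iInter fun _ =>
    isClosed_eq (by fun_prop) continuous_const

/-- Restriction of a density to the complement of `S`. -/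
noncomputable def restrictCompl (S : Set ℝ) : LOne →L[ℂ] Lp ℂ 1 (volume.restrict Sᶜ) :=
  LpToLpRestrictCLM ℝ ℂ ℂ volume 1 Sᶜ

lemma restrictCompl_eq_zero_iff {S : Set ℝ} (hS : MeasurableSet S) (k : LOne) :
    restrictCompl S k = 0 ↔ ∀ᵐ s, s ∉ S → k s = 0 := by
  have hae : (∀ᵐ s, s ∉ S → k s = 0) ↔ ∀ᵐ s ∂volume.restrict Sᶜ, k s = 0 :=
    (ae_restrict_iff' hS.compl).symm
  rw [Lp.eq_zero_iff_ae_eq_zero, hae]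
  have h := LpToLpRestrictCLM_coeFn ℂ (μ := volume) (p := 1) Sᶜ k
  constructor
  · intro h0
    filter_upwards [h, h0] with s h1 h2
    rw [← h1]
    exact h2
  · intro h0
    filter_upwards [h, h0] with s h1 h2
    exact h1.trans h2

/-- The subalgebra of elements whose frequencies lie in the monoid `S` and whose density vanishes
almost everywhere off `S`. -/
noncomputable def spectrumIn (S : AddSubmonoid ℝ) (hS : MeasurableSet (S : Set ℝ)) :
    Subalgebra ℂ GAlg where
  carrier := {a | a ∈ coeffOn S ∧ ∀ᵐ s, s ∉ S → dens a s = 0}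
  mul_mem' := by
    rintro a b ⟨ha, ha'⟩ ⟨hb, hb'⟩
    refine ⟨mul_mem ha hb, ?_⟩
    have mixed : ∀ (c : EllOne) (k : LOne), (∀ x ∉ S, c x = 0) →
        (∀ᵐ s, s ∉ S → k s = 0) → restrictCompl S (convMixed c k) = 0 := by
      intro c k hc hk
      rw [convMixed, map_weightedSum _ (fun x => ((LOne.shift x).norm_map k).le)]
      refine (tsum_congr fun x => ?_).trans tsum_zero
      by_cases hx : x ∈ S
      · have : restrictCompl S (LOne.shift x k) = 0 := by
          rw [restrictCompl_eq_zero_iff hS]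
          have hq := (measurePreserving_sub_right volume x).quasiMeasurePreserving.ae hk
          filter_upwards [LOne.coeFn_shift x k, hq] with s h1 h2 hs
          rw [h1]
          exact h2 fun h => hs (by simpa using S.add_mem h hx)
        rw [this, smul_zero]
      · rw [hc x hx, zero_smul]
    have both : restrictCompl S (convInt (dens a) (dens b)) = 0 := by
      rw [restrictCompl_eq_zero_iff hS]
      filter_upwards [Integrable.coeFn_toL1
        (integrable_conv (L1.integrable_coeFn (dens a)) (L1.integrable_coeFn (dens b)))] with s h1 hs
      rw [convInt, h1, conv_apply]
      refine (integral_congr_ae ?_).trans (integral_zero ℝ ℂ)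
      have hq := (Measure.measurePreserving_sub_left volume s).quasiMeasurePreserving.ae hb'
      filter_upwards [ha', hq] with x h2 h3
      by_cases hx : x ∈ S
      · rw [h3 fun h => hs (by simpa using S.add_mem hx h), mul_zero]
      · rw [h2 hx, zero_mul]
    change ∀ᵐ s, s ∉ (S : Set ℝ) → dens (a * b) s = 0
    rw [← restrictCompl_eq_zero_iff hS, dens_mul, map_add, map_add, mixed _ _ ha hb',
      mixed _ _ hb ha', both, add_zero, add_zero]
  add_mem' := by
    rintro a b ⟨ha, ha'⟩ ⟨hb, hb'⟩
    refine ⟨add_mem ha hb, ?_⟩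
    rw [map_add]
    filter_upwards [ha', hb', Lp.coeFn_add (dens a) (dens b)] with s h1 h2 h3 hs
    rw [h3, Pi.add_apply, h1 hs, h2 hs, add_zero]
  algebraMap_mem' := by
    intro z
    refine ⟨Subalgebra.algebraMap_mem _ z, ?_⟩
    rw [Algebra.algebraMap_eq_smul_one, map_smul, dens_one, smul_zero]
    filter_upwards [Lp.coeFn_zero ℂ 1 (volume : Measure ℝ)] with s h1 _
    rw [h1, Pi.zero_apply]

lemma isClosed_spectrumIn (S : AddSubmonoid ℝ) (hS : MeasurableSet (S : Set ℝ)) :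
    IsClosed (spectrumIn S hS : Set GAlg) := by
  have : (spectrumIn S hS : Set GAlg) =
      (coeffOn S : Set GAlg) ∩ {a | restrictCompl S (dens a) = 0} := by
    ext a
    simp only [Set.mem_inter_iff, Set.mem_ofPred_eq, restrictCompl_eq_zero_iff hS]
    exact Iff.rfl
  rw [this]
  exact (isClosed_coeffOn S).inter (isClosed_eq (by fun_prop) continuous_const)

/-- The half-line `[0, ∞)` as a monoid. -/
def rightHalf : AddSubmonoid ℝ where
  carrier := Set.Ici 0
  add_mem' := fun ha hb => add_nonneg (Set.mem_Ici.1 ha) (Set.mem_Ici.1 hb)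
  zero_mem' := Set.mem_Ici.2 le_rfl

/-- The half-line `(-∞, 0]` as a monoid. -/
def leftHalf : AddSubmonoid ℝ where
  carrier := Set.Iic 0
  add_mem' := fun ha hb => add_nonpos (Set.mem_Iic.1 ha) (Set.mem_Iic.1 hb)
  zero_mem' := Set.mem_Iic.2 le_rfl

lemma notMem_rightHalf {x : ℝ} : x ∉ rightHalf ↔ x < 0 :=
  not_le (a := (0 : ℝ)) (b := x)

lemma notMem_leftHalf {x : ℝ} : x ∉ leftHalf ↔ 0 < x :=
  not_le (a := x) (b := (0 : ℝ))

/-- The model of `G⁺`. -/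
noncomputable def plus : Subalgebra ℂ GAlg := spectrumIn rightHalf measurableSet_Ici

/-- The model of `G⁻`. -/
noncomputable def minus : Subalgebra ℂ GAlg := spectrumIn leftHalf measurableSet_Iic

lemma exp_mem_plus {a : GAlg} (ha : a ∈ plus) : NormedSpace.exp a ∈ plus :=
  NormedSpace.exp_mem (R := ℂ) (isClosed_spectrumIn _ _) ha

lemma exp_mem_minus {a : GAlg} (ha : a ∈ minus) : NormedSpace.exp a ∈ minus :=
  NormedSpace.exp_mem (R := ℂ) (isClosed_spectrumIn _ _) ha

lemma exists_add_eq (a : GAlg) : ∃ u ∈ minus, ∃ v ∈ plus, u + v = a := by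
  classical
  have hk := (L1.integrable_coeFn (dens a)).indicator (measurableSet_Ici (a := (0 : ℝ)))
  have hc : Summable fun x => ‖(Set.Ici (0 : ℝ)).indicator (coeff a) x‖ :=
    (coeff a).summable_norm.of_nonneg_of_le (fun _ => norm_nonneg _)
      fun x => norm_indicator_le_norm_self _ _
  let v : GAlg := mk (EllOne.of _ hc) (hk.toL1 _)
  have hv : v ∈ plus := by
    refine ⟨fun x hx => ?_, ?_⟩
    · exact Set.indicator_of_notMem hx _
    · filter_upwards [Integrable.coeFn_toL1 hk] with s h1 hs
      rw [dens_mk, h1]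
      exact Set.indicator_of_notMem hs _
  refine ⟨a - v, ⟨fun x hx => ?_, ?_⟩, v, hv, sub_add_cancel a v⟩
  · rw [coeff_sub_apply, coeff_mk, EllOne.of_apply,
      Set.indicator_of_mem (Set.mem_Ici.2 (notMem_leftHalf.1 hx).le), sub_self]
  · rw [map_sub, dens_mk]
    filter_upwards [Integrable.coeFn_toL1 hk, Lp.coeFn_sub (dens a) (hk.toL1 _)] with s h1 h2 hs
    rw [h2, Pi.sub_apply, h1,
      Set.indicator_of_mem (Set.mem_Ici.2 (notMem_leftHalf.1 hs).le), sub_self]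

/-- Only constants have both a nonnegative and a nonpositive spectrum. -/
lemma eval_eq_of_mem_minus_of_mem_plus {a : GAlg} (h1 : a ∈ minus) (h2 : a ∈ plus) (t : ℝ) :
    eval t a = coeff a 0 := by
  have hd : fourierInt (dens a) t = 0 := by
    refine (integral_congr_ae ?_).trans (integral_zero ℝ ℂ)
    filter_upwards [h1.2, h2.2, Measure.ae_ne volume (0 : ℝ)] with s hs1 hs2 hs
    rcases lt_or_gt_of_ne hs with h | h
    · rw [hs2 (notMem_rightHalf.2 h), zero_mul]
    · rw [hs1 (notMem_leftHalf.2 h), zero_mul]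
  rw [eval_eq, hd, add_zero, apSum, tsum_eq_single 0]
  · simp
  · intro x hx
    rcases lt_or_gt_of_ne hx with h | h
    · rw [h2.1 x (notMem_rightHalf.2 h), zero_mul]
    · rw [h1.1 x (notMem_leftHalf.2 h), zero_mul]

/-! ### Comparison with the function spaces -/

lemma exists_eval_of_spectrum {S : AddSubmonoid ℝ} (hS : MeasurableSet (S : Set ℝ)) {c k : ℝ → ℂ}
    (hc : Summable fun δ => ‖c δ‖) (hk : Integrable k) (hcS : ∀ δ ∉ S, c δ = 0)
    (hkS : ∀ s ∉ S, k s = 0) :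
    ∃ x ∈ spectrumIn S hS, ∀ t, (apSum c + fourierInt k) t = eval t x := by
  refine ⟨mk (EllOne.of c hc) (hk.toL1 k), ⟨hcS, ?_⟩, fun t => ?_⟩
  · filter_upwards [Integrable.coeFn_toL1 hk] with s h1 hs
    rw [dens_mk, h1, hkS s hs]
  · rw [eval_mk, fourierInt_congr (Integrable.coeFn_toL1 hk)]
    rfl

lemma exists_spectrum_of_eval {S : AddSubmonoid ℝ} {hS : MeasurableSet (S : Set ℝ)} {x : GAlg}
    (hx : x ∈ spectrumIn S hS) : ∃ c k : ℝ → ℂ, Summable (fun δ => ‖c δ‖) ∧ Integrable k ∧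
      (∀ δ ∉ S, c δ = 0) ∧ (∀ s ∉ S, k s = 0) ∧ (fun t => eval t x) = apSum c + fourierInt k := by
  classical
  refine ⟨coeff x, (S : Set ℝ).indicator (dens x), (coeff x).summable_norm,
    (L1.integrable_coeFn (dens x)).indicator hS, hx.1,
    fun s hs => Set.indicator_of_notMem hs _, ?_⟩
  have : (S : Set ℝ).indicator (dens x) =ᵐ[volume] dens x := by
    filter_upwards [hx.2] with s hs
    by_cases h : s ∈ S
    · exact Set.indicator_of_mem h _
    · rw [hs h]
      exact Set.indicator_of_notMem h _
  rw [fourierInt_congr this]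
  rfl

lemma mem_G_iff {f : ℝ → ℂ} : f ∈ G ↔ ∃ x : GAlg, ∀ t, f t = eval t x := by
  constructor
  · rintro ⟨c, k, hc, hk, rfl⟩
    obtain ⟨x, -, hx⟩ := exists_eval_of_spectrum (S := ⊤) MeasurableSet.univ hc hk
      (by simp) (by simp)
    exact ⟨x, hx⟩
  · rintro ⟨x, hx⟩
    exact ⟨coeff x, dens x, (coeff x).summable_norm, L1.integrable_coeFn _, funext hx⟩

lemma mem_Gplus_iff {f : ℝ → ℂ} : f ∈ Gplus ↔ ∃ x ∈ plus, ∀ t, f t = eval t x := by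
  constructor
  · rintro ⟨c, k, hc, hk, hc0, hk0, rfl⟩
    exact exists_eval_of_spectrum _ hc hk (fun x hx => hc0 x (notMem_rightHalf.1 hx))
      fun x hx => hk0 x (notMem_rightHalf.1 hx)
  · rintro ⟨x, hx, hf⟩
    obtain ⟨c, k, hc, hk, hc0, hk0, h⟩ := exists_spectrum_of_eval hx
    exact ⟨c, k, hc, hk, fun x hx => hc0 x (notMem_rightHalf.2 hx),
      fun x hx => hk0 x (notMem_rightHalf.2 hx), (funext hf).trans h⟩

lemma mem_Gminus_iff {f : ℝ → ℂ} : f ∈ Gminus ↔ ∃ x ∈ minus, ∀ t, f t = eval t x := by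
  constructor
  · rintro ⟨c, k, hc, hk, hc0, hk0, rfl⟩
    exact exists_eval_of_spectrum _ hc hk (fun x hx => hc0 x (notMem_leftHalf.1 hx))
      fun x hx => hk0 x (notMem_leftHalf.1 hx)
  · rintro ⟨x, hx, hf⟩
    obtain ⟨c, k, hc, hk, hc0, hk0, h⟩ := exists_spectrum_of_eval hx
    exact ⟨c, k, hc, hk, fun x hx => hc0 x (notMem_leftHalf.2 hx),
      fun x hx => hk0 x (notMem_leftHalf.2 hx), (funext hf).trans h⟩

lemma mem_APw_iff {f : ℝ → ℂ} : f ∈ APw ↔ ∃ x : GAlg, dens x = 0 ∧ ∀ t, f t = eval t x := by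
  have h0 : ∀ t, fourierInt ((0 : LOne) : ℝ → ℂ) t = 0 := fun t => map_zero (evalInt t)
  constructor
  · rintro ⟨c, hc, rfl⟩
    refine ⟨mk (EllOne.of c hc) 0, rfl, fun t => ?_⟩
    rw [eval_mk, h0, add_zero]
    rfl
  · rintro ⟨x, hx, hf⟩
    refine ⟨coeff x, (coeff x).summable_norm, funext fun t => ?_⟩
    rw [hf, eval_eq, hx, h0, add_zero]

lemma mem_L0_iff {f : ℝ → ℂ} : f ∈ L0 ↔ ∃ x : GAlg, coeff x = 0 ∧ ∀ t, f t = eval t x := by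
  have h0 : ∀ t, apSum ((0 : EllOne) : ℝ → ℂ) t = 0 := fun t => map_zero (evalSum t)
  constructor
  · rintro ⟨k, hk, rfl⟩
    refine ⟨mk 0 (hk.toL1 k), rfl, fun t => ?_⟩
    rw [eval_mk, h0, zero_add, fourierInt_congr (Integrable.coeFn_toL1 hk)]
  · rintro ⟨x, hx, hf⟩
    refine ⟨dens x, L1.integrable_coeFn _, funext fun t => ?_⟩
    rw [hf, eval_eq, hx, h0, zero_add]

/-! ### Coefficient multipliers and derivations -/

lemma apPart_eq_iff {a b : GAlg} : apPart a = apPart b ↔ coeff a = coeff b :=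
  ⟨fun h => by rw [← coeff_apPart, h, coeff_apPart], fun h => ext h rfl⟩

/-- The almost periodic element with coefficients `m(x) c(x)`, where `c` are the coefficients
of `a` and `|m| ≤ 1`. -/
noncomputable def mask (m : ℝ → ℂ) (hm : ∀ x, ‖m x‖ ≤ 1) (a : GAlg) : GAlg :=
  mk (EllOne.of (fun x => m x * coeff a x)
    ((coeff a).summable_norm.of_nonneg_of_le (fun _ => norm_nonneg _) fun x => by
      rw [norm_mul]
      exact mul_le_of_le_one_left (norm_nonneg _) (hm x))) 0

@[simp] lemma coeff_mask (m : ℝ → ℂ) (hm : ∀ x, ‖m x‖ ≤ 1) (a : GAlg) (x : ℝ) :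
    coeff (mask m hm a) x = m x * coeff a x := rfl

lemma apPart_mask (m : ℝ → ℂ) (hm : ∀ x, ‖m x‖ ≤ 1) (a : GAlg) :
    apPart (mask m hm a) = mask m hm a := rfl

lemma tendsto_mask {ι : Type*} {l : Filter ι} {m : ι → ℝ → ℂ} (hm : ∀ i x, ‖m i x‖ ≤ 1)
    (hlim : ∀ x, Tendsto (fun i => m i x) l (𝓝 1)) (a : GAlg) :
    Tendsto (fun i => mask (m i) (hm i) a) l (𝓝 (apPart a)) := by
  rw [tendsto_iff_norm_sub_tendsto_zero]
  have h1 : ∀ i, ‖mask (m i) (hm i) a - apPart a‖ = ∑' x, ‖(m i x - 1) * coeff a x‖ := by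
    intro i
    have hd : dens (mask (m i) (hm i) a - apPart a) = 0 := by
      rw [map_sub, dens_apPart, sub_eq_zero]; rfl
    rw [norm_eq, hd, norm_zero, add_zero, EllOne.norm_eq]
    refine tsum_congr fun x => ?_
    rw [coeff_sub_apply, coeff_mask, coeff_apPart, sub_mul, one_mul]
  simp only [h1]
  have h2 : Tendsto (fun i => ∑' x, ‖(m i x - 1) * coeff a x‖) l (𝓝 (∑' _ : ℝ, (0 : ℝ))) := by
    refine tendsto_tsum_of_dominated_convergence ((coeff a).summable_norm.mul_left 2)
      (fun x => ?_) (Eventually.of_forall fun i x => ?_)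
    · have := (((hlim x).sub_const 1).mul_const (coeff a x)).norm
      simpa using this
    · rw [norm_norm, norm_mul]
      refine mul_le_mul_of_nonneg_right ?_ (norm_nonneg _)
      refine (norm_sub_le _ _).trans ?_
      rw [norm_one]
      linarith [hm i x]
  simpa using h2

/-- `b` is obtained from `a` by multiplying the coefficient at `x` by `φ x`. For `φ x = x` this
is, up to the factor `i`, differentiation of almost periodic functions; the other additive `φ`
play the role of partial derivatives in the directions of rationally independent frequencies. -/
def IsDeriv (φ : ℝ →+ ℝ) (a b : GAlg) : Prop := ∀ x, coeff b x = (φ x : ℂ) * coeff a x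

lemma IsDeriv.mul {φ : ℝ →+ ℝ} {a a' b b' : GAlg} (ha : IsDeriv φ a a') (hb : IsDeriv φ b b') :
    IsDeriv φ (a * b) (a' * b + a * b') := by
  intro y
  rw [coeff_add_apply, coeff_mul_apply, coeff_mul_apply, coeff_mul_apply,
    ← (summable_coeff_mul a' b y).tsum_add (summable_coeff_mul a b' y), ← tsum_mul_left]
  refine tsum_congr fun x => ?_
  have h : φ y = φ x + φ (y - x) := by rw [← map_add, add_sub_cancel]
  rw [ha, hb, h]
  push_cast
  ring

lemma IsDeriv.neg {φ : ℝ →+ ℝ} {a a' : GAlg} (ha : IsDeriv φ a a') : IsDeriv φ (-a) (-a') := by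
  intro y
  rw [coeff_neg_apply, coeff_neg_apply, ha, mul_neg]

lemma isDeriv_one (φ : ℝ →+ ℝ) : IsDeriv φ 1 0 := by
  intro y
  rw [map_zero, coeff_one_apply]
  by_cases h : y = 0
  · subst h; simp
  · simp [h]

lemma IsDeriv.pow {φ : ℝ →+ ℝ} {a a' : GAlg} (ha : IsDeriv φ a a') (n : ℕ) :
    IsDeriv φ (a ^ (n + 1)) (((n + 1 : ℕ) : ℂ) • (a ^ n * a')) := by
  induction n with
  | zero => simpa using ha
  | succ n ih =>
    have h := ih.mul ha
    rw [← pow_succ] at h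
    convert h using 1
    rw [smul_mul_assoc, Nat.cast_succ (n + 1), add_smul, one_smul]
    congr 1
    rw [pow_succ, mul_right_comm]

lemma IsDeriv.exp {φ : ℝ →+ ℝ} {a a' : GAlg} (ha : IsDeriv φ a a') :
    IsDeriv φ (NormedSpace.exp a) (NormedSpace.exp a * a') := by
  intro y
  have hexp := NormedSpace.exp_series_hasSum_exp' (𝕂 := ℂ) a
  have h1 : HasSum (fun n : ℕ => (φ y : ℂ) * coeff (((n.factorial : ℂ)⁻¹) • a ^ n) y)
      ((φ y : ℂ) * coeff (NormedSpace.exp a) y) :=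
    ((((coeffCLM y).comp coeff).hasSum hexp).mul_left _)
  have h2 : HasSum (fun n : ℕ => coeff (((n.factorial : ℂ)⁻¹) • a ^ n * a') y)
      (coeff (NormedSpace.exp a * a') y) :=
    ((coeffCLM y).comp coeff).hasSum (hexp.mul_right a')
  rw [← hasSum_nat_add_iff' 1] at h1
  have h0 : (φ y : ℂ) * coeff (((Nat.factorial 0 : ℂ)⁻¹) • a ^ 0) y = 0 := by
    rw [Nat.factorial_zero, Nat.cast_one, inv_one, one_smul, pow_zero, ← isDeriv_one φ y, map_zero]
    rfl
  rw [Finset.sum_range_one, h0, sub_zero] at h1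
  have h4 : ∀ n : ℕ, (φ y : ℂ) * coeff ((((n + 1).factorial : ℂ)⁻¹) • a ^ (n + 1)) y =
      coeff (((n.factorial : ℂ)⁻¹) • a ^ n * a') y := by
    intro n
    have hp := ha.pow n y
    rw [coeff_smul_apply] at hp
    rw [smul_mul_assoc, coeff_smul_apply, coeff_smul_apply, mul_left_comm, ← hp,
      Nat.factorial_succ]
    have h3 : ((n + 1 : ℕ) : ℂ) ≠ 0 := Nat.cast_ne_zero.2 n.succ_ne_zero
    rw [Nat.cast_mul, mul_inv, mul_right_comm, ← mul_assoc, inv_mul_cancel₀ h3, one_mul, mul_comm]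
  simp only [h4] at h1
  exact h2.unique h1

/-- An additive functional twists the coefficients by a character of the discrete real line; this
is an automorphism of the almost periodic part. -/
noncomputable def twist (φ : ℝ →+ ℝ) (s : ℝ) (a : GAlg) : GAlg :=
  mask (fun x => Complex.exp (Complex.I * (φ x : ℂ) * (s : ℂ)))
    (fun x => (norm_exp_I_mul_mul (φ x) s).le) a

lemma twist_mul (φ : ℝ →+ ℝ) (s : ℝ) (a b : GAlg) :
    twist φ s (a * b) = twist φ s a * twist φ s b := by
  have h : twist φ s a * twist φ s b = apPart (twist φ s a * twist φ s b) := by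
    rw [map_mul]; rfl
  rw [h, twist, ← apPart_mask, apPart_eq_iff]
  refine lp.ext (funext fun y => ?_)
  rw [coeff_mask, coeff_mul_apply, coeff_mul_apply, ← tsum_mul_left]
  refine tsum_congr fun x => ?_
  have hy : φ y = φ x + φ (y - x) := by rw [← map_add, add_sub_cancel]
  simp only [twist, coeff_mask]
  rw [hy, exp_I_add_mul]
  ring

lemma twist_one (φ : ℝ →+ ℝ) (s : ℝ) : twist φ s 1 = 1 := by
  have h : (1 : GAlg) = apPart 1 := (map_one _).symm
  rw [twist, ← apPart_mask]
  conv_rhs => rw [h]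
  rw [apPart_eq_iff]
  refine lp.ext (funext fun y => ?_)
  rw [coeff_mask, coeff_one_apply]
  by_cases hy : y = 0
  · subst hy; simp
  · simp [hy]

/-- The difference quotient `(e^{iφ(x)s} - 1) / (iφ(x)s)`. -/
noncomputable def expQuot (φ : ℝ →+ ℝ) (s x : ℝ) : ℂ :=
  if φ x * s = 0 then 1 else
    (Complex.exp (Complex.I * (φ x : ℂ) * (s : ℂ)) - 1) / (Complex.I * (φ x : ℂ) * (s : ℂ))

lemma expQuot_mul (φ : ℝ →+ ℝ) (s x : ℝ) :
    Complex.I * (s : ℂ) * ((φ x : ℂ) * expQuot φ s x) =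
      Complex.exp (Complex.I * (φ x : ℂ) * (s : ℂ)) - 1 := by
  unfold expQuot
  split_ifs with h
  · have h' : Complex.I * (φ x : ℂ) * (s : ℂ) = 0 := by
      rw [mul_assoc, ← Complex.ofReal_mul, h, Complex.ofReal_zero, mul_zero]
    rw [h', Complex.exp_zero, sub_self, ← h']
    ring
  · have h' : Complex.I * (φ x : ℂ) * (s : ℂ) ≠ 0 := by
      rw [mul_assoc, ← Complex.ofReal_mul]
      exact mul_ne_zero Complex.I_ne_zero (Complex.ofReal_ne_zero.2 h)
    rw [show ∀ z : ℂ, Complex.I * (s : ℂ) * ((φ x : ℂ) * z) =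
      Complex.I * (φ x : ℂ) * (s : ℂ) * z from fun z => by ring, mul_div_cancel₀ _ h']

lemma norm_expQuot_le (φ : ℝ →+ ℝ) (s x : ℝ) : ‖expQuot φ s x‖ ≤ 1 := by
  unfold expQuot
  split_ifs with h
  · simp
  · have := Real.norm_exp_I_mul_ofReal_sub_one_le (x := φ x * s)
    rw [mul_assoc, ← Complex.ofReal_mul, norm_div, norm_mul, Complex.norm_I, one_mul,
      Complex.norm_real]
    exact div_le_one_of_le₀ this (norm_nonneg _)

lemma tendsto_expQuot (φ : ℝ →+ ℝ) (x : ℝ) :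
    Tendsto (fun s => expQuot φ s x) (𝓝[≠] 0) (𝓝 1) := by
  by_cases h : φ x = 0
  · refine tendsto_const_nhds.congr fun s => ?_
    rw [expQuot, if_pos (by rw [h, zero_mul])]
  · have hd : HasDerivAt (fun s : ℝ => Complex.exp (Complex.I * (φ x : ℂ) * (s : ℂ)))
        (Complex.I * (φ x : ℂ)) 0 := by
      have h1 : HasDerivAt (fun s : ℝ => Complex.I * (φ x : ℂ) * (s : ℂ))
          (Complex.I * (φ x : ℂ)) 0 := by
        simpa using (Complex.ofRealCLM.hasDerivAt (x := (0 : ℝ))).const_mul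
          (Complex.I * (φ x : ℂ))
      simpa using h1.cexp
    have hslope := hd.tendsto_slope
    have hne : Complex.I * (φ x : ℂ) ≠ 0 :=
      mul_ne_zero Complex.I_ne_zero (Complex.ofReal_ne_zero.2 h)
    have h2 := hslope.const_mul (Complex.I * (φ x : ℂ))⁻¹
    rw [inv_mul_cancel₀ hne] at h2
    refine h2.congr' ?_
    filter_upwards [self_mem_nhdsWithin] with s hs
    have hs' : s ≠ 0 := hs
    rw [expQuot, if_neg (mul_ne_zero h hs'), slope_def_module, Complex.real_smul]
    simp only [sub_zero, Complex.ofReal_zero, mul_zero, Complex.exp_zero]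
    have hsC : (s : ℂ) ≠ 0 := Complex.ofReal_ne_zero.2 hs'
    push_cast
    field_simp

/-- The quotient rule for inverses. That the derivative of the inverse exists is not automatic; it
is obtained by differentiating `s ↦ twist φ s x` at `s = 0`. -/
lemma IsDeriv.inv {φ : ℝ →+ ℝ} {a a' x : GAlg} (ha : IsDeriv φ a a') (hax : a * x = 1) :
    IsDeriv φ x (-(x * x * a')) := by
  intro y
  let q : ℝ → GAlg := fun s => mask (expQuot φ s) (norm_expQuot_le φ s) a'
  have key : ∀ s : ℝ, s ≠ 0 → (φ y : ℂ) * expQuot φ s y * coeff x y =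
      -coeff (twist φ s x * x * q s) y := by
    intro s hs
    have htw : twist φ s x * twist φ s a = 1 := by
      rw [← twist_mul, mul_comm x a, hax, twist_one]
    have h1 : twist φ s x - x = twist φ s x * x * (a - twist φ s a) := by
      linear_combination (-twist φ s x) * hax + x * htw
    have hc : coeff (a - twist φ s a) = coeff ((-(Complex.I * (s : ℂ))) • q s) := by
      refine lp.ext (funext fun z => ?_)
      rw [coeff_sub_apply, coeff_smul_apply]
      simp only [q, twist, coeff_mask]
      rw [ha]
      linear_combination (coeff a z) * expQuot_mul φ s z
    have h2 := congrArg (fun u => coeff u y) h1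
    simp only at h2
    rw [coeff_mul_congr rfl hc, coeff_sub_apply, mul_smul_comm, coeff_smul_apply] at h2
    simp only [twist, coeff_mask] at h2
    have hIs : Complex.I * (s : ℂ) ≠ 0 :=
      mul_ne_zero Complex.I_ne_zero (Complex.ofReal_ne_zero.2 hs)
    refine mul_left_cancel₀ hIs ?_
    simp only [twist]
    linear_combination h2 + coeff x y * expQuot_mul φ s y
  have hl1 : Tendsto (fun s => (φ y : ℂ) * expQuot φ s y * coeff x y) (𝓝[≠] 0)
      (𝓝 ((φ y : ℂ) * 1 * coeff x y)) :=
    ((tendsto_expQuot φ y).const_mul _).mul_const _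
  have hq : Tendsto q (𝓝[≠] 0) (𝓝 (apPart a')) := tendsto_mask _ (tendsto_expQuot φ) a'
  have htw : Tendsto (fun s => twist φ s x) (𝓝[≠] 0) (𝓝 (apPart x)) := by
    refine tendsto_mask _ (fun z => ?_) x
    have : Continuous fun s : ℝ => Complex.exp (Complex.I * (φ z : ℂ) * (s : ℂ)) := by fun_prop
    simpa using (this.tendsto 0).mono_left nhdsWithin_le_nhds
  have hl2 : Tendsto (fun s => -coeff (twist φ s x * x * q s) y) (𝓝[≠] 0)
      (𝓝 (-coeff (apPart x * x * apPart a') y)) :=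
    ((((coeffCLM y).comp coeff).continuous.tendsto _).comp ((htw.mul_const x).mul hq)).neg
  have hlim := tendsto_nhds_unique (hl1.congr' (by
    filter_upwards [self_mem_nhdsWithin] with s hs using key s hs)) hl2
  rw [mul_one] at hlim
  rw [hlim, coeff_neg_apply, coeff_mul_congr (coeff_mul_congr (coeff_apPart x).symm rfl)
    (coeff_apPart a').symm]

/-! ### Logarithms of almost periodic elements -/

/-- Finitely many frequencies generate a lattice: there are finitely many additive functionals on
the line which are integral on the generated group and separate its points from `0`. -/
lemma exists_integral_coordinates (F : Finset ℝ) :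
    ∃ (J : Finset (Module.Basis.ofVectorSpaceIndex ℚ ℝ))
      (φ : Module.Basis.ofVectorSpaceIndex ℚ ℝ → ℝ →+ ℝ),
      ∀ y ∈ AddSubgroup.closure (F : Set ℝ),
        (∀ j ∈ J, ∃ n : ℤ, φ j y = n) ∧ ((∀ j ∈ J, φ j y = 0) → y = 0) := by
  classical
  let b := Module.Basis.ofVectorSpace ℚ ℝ
  let J := F.biUnion fun x => (b.repr x).support
  let N : ℕ := ∏ x ∈ F, ∏ j ∈ J, (b.repr x j).den
  have hN : (N : ℚ) ≠ 0 := by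
    refine Nat.cast_ne_zero.2 (Finset.prod_ne_zero_iff.2 fun x _ => ?_)
    exact Finset.prod_ne_zero_iff.2 fun j _ => (b.repr x j).den_nz
  let φ : Module.Basis.ofVectorSpaceIndex ℚ ℝ → ℝ →+ ℝ := fun j =>
    (Rat.castHom ℝ).toAddMonoidHom.comp ((N : ℚ) • b.coord j).toAddMonoidHom
  have hφ : ∀ j y, φ j y = (((N : ℚ) * b.repr y j : ℚ) : ℝ) := fun j y => rfl
  refine ⟨J, φ, fun y hy => ?_⟩
  have key : (∀ j ∈ J, ∃ n : ℤ, (N : ℚ) * b.repr y j = n) ∧ ∀ j ∉ J, b.repr y j = 0 := by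
    induction hy using AddSubgroup.closure_induction with
    | mem x hx =>
      refine ⟨fun j hj => ?_, fun j hj => ?_⟩
      · have hd : (b.repr x j).den ∣ N :=
          (Finset.dvd_prod_of_mem _ hj).trans
            (Finset.dvd_prod_of_mem (fun x => ∏ j ∈ J, (b.repr x j).den) hx)
        obtain ⟨m, hm⟩ := hd
        refine ⟨m * (b.repr x j).num, ?_⟩
        rw [hm]
        push_cast
        rw [mul_comm ((b.repr x j).den : ℚ), mul_assoc, Rat.den_mul_eq_num]
      · by_contra h
        exact hj (Finset.mem_biUnion.2 ⟨x, hx, Finsupp.mem_support_iff.2 h⟩)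
    | zero => exact ⟨fun j _ => ⟨0, by simp⟩, fun j _ => by simp⟩
    | add x z _ _ hx hz =>
      refine ⟨fun j hj => ?_, fun j hj => ?_⟩
      · obtain ⟨n, hn⟩ := hx.1 j hj
        obtain ⟨m, hm⟩ := hz.1 j hj
        exact ⟨n + m, by rw [map_add, Finsupp.add_apply, mul_add, hn, hm, Int.cast_add]⟩
      · rw [map_add, Finsupp.add_apply, hx.2 j hj, hz.2 j hj, add_zero]
    | neg x _ hx =>
      refine ⟨fun j hj => ?_, fun j hj => ?_⟩
      · obtain ⟨n, hn⟩ := hx.1 j hj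
        exact ⟨-n, by rw [map_neg, Finsupp.neg_apply, mul_neg, hn, Int.cast_neg]⟩
      · rw [map_neg, Finsupp.neg_apply, hx.2 j hj, neg_zero]
  refine ⟨fun j hj => ?_, fun h => ?_⟩
  · obtain ⟨n, hn⟩ := key.1 j hj
    exact ⟨n, by rw [hφ, hn, Rat.cast_intCast]⟩
  · rw [← b.repr.map_eq_zero_iff]
    ext j
    by_cases hj : j ∈ J
    · have h1 := h j hj
      rw [hφ, Rat.cast_eq_zero] at h1
      exact (mul_eq_zero.1 h1).resolve_left hN
    · exact key.2 j hj

/-- The inverse of an element has its frequencies in the group generated by those of the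
element. -/
lemma inv_mem_coeffOn {H : AddSubgroup ℝ} {p x : GAlg} (hp : p ∈ coeffOn H.toAddSubmonoid)
    (hpx : p * x = 1) : x ∈ coeffOn H.toAddSubmonoid := by
  classical
  let m : ℝ → ℂ := fun y => if y ∈ H then 1 else 0
  have hm : ∀ y, ‖m y‖ ≤ 1 := fun y => by
    by_cases h : y ∈ H <;> simp [m, h]
  have h1 : apPart p * mask m hm x = 1 := by
    have h2 : apPart p * mask m hm x = apPart (p * mask m hm x) := by
      rw [map_mul, apPart_mask]
    rw [h2, ← map_one apPart, apPart_eq_iff]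
    refine lp.ext (funext fun y => ?_)
    have h3 : coeff (p * mask m hm x) y = m y * coeff (p * x) y := by
      rw [coeff_mul_apply, coeff_mul_apply, ← tsum_mul_left]
      refine tsum_congr fun z => ?_
      by_cases hz : z ∈ H
      · have h4 : m (y - z) = m y := by
          simp only [m, sub_eq_add_neg, H.add_mem_cancel_right (H.neg_mem hz)]
        rw [coeff_mask, h4]
        ring
      · rw [hp z hz]
        ring
    rw [h3, hpx, coeff_one_apply]
    by_cases hy : y = 0
    · subst hy
      simp [m, H.zero_mem]
    · simp [hy]
  have h2 : apPart p * apPart x = 1 := by rw [← map_mul, hpx, map_one]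
  have h3 : mask m hm x = apPart x := by
    linear_combination (-mask m hm x) * h2 + apPart x * h1
  intro y hy
  rw [← coeff_apPart, ← h3, coeff_mask]
  have : m y = 0 := if_neg hy
  rw [this, zero_mul]

/-- The single frequency `e^{iλt}`. -/
noncomputable def freq (x : ℝ) : GAlg := mk (lp.single 1 x 1) 0

lemma eval_freq (t x : ℝ) : eval t (freq x) = Complex.exp (Complex.I * (x : ℂ) * (t : ℂ)) := by
  rw [freq, eval_mk, apSum_single, ← evalInt_apply, map_zero, one_mul, add_zero]

lemma exists_exp_eq_smul {z : ℂ} (hz : z ≠ 0) : ∃ f : GAlg, NormedSpace.exp f = z • (1 : GAlg) := by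
  refine ⟨Complex.log z • 1, eval_injective fun t => ?_⟩
  rw [eval_exp, map_smul, map_smul, eval_one, smul_eq_mul, smul_eq_mul, mul_one, mul_one,
    Complex.exp_log hz]

lemma isDeriv_of_finite_support (φ : ℝ →+ ℝ) {p : GAlg} {F : Finset ℝ}
    (hF : ∀ x ∉ F, coeff p x = 0) : ∃ p' : GAlg, IsDeriv φ p p' := by
  refine ⟨mk (EllOne.of (fun x => (φ x : ℂ) * coeff p x) ?_) 0, fun x => rfl⟩
  refine summable_of_ne_finset_zero (s := F) fun x hx => ?_
  rw [hF x hx, mul_zero, norm_zero]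

/-- An invertible almost periodic polynomial is a single frequency times an exponential: its
logarithmic derivatives `q j` in the coordinate directions satisfy the integrability condition
`φ i q j = φ j q i`, hence have a common primitive `L`, whose coefficients are absolutely summable
because the nonzero lattice points have norm at least one. All logarithmic derivatives of
`p exp (-L)` are constants, so that it has one frequency only. -/
lemma apPart_eq_freq_mul_exp_of_finite_support {p x : GAlg} (hpx : p * x = 1) {F : Finset ℝ}
    (hF : ∀ y ∉ F, coeff p y = 0) :
    ∃ (μ : ℝ) (f : GAlg), apPart p = freq μ * NormedSpace.exp f := by
  classical
  obtain ⟨J, φ, hJ⟩ := exists_integral_coordinates F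
  set H := AddSubgroup.closure (F : Set ℝ) with hH
  choose p' hp' using fun j => isDeriv_of_finite_support (φ j) hF
  have hF' : ∀ j, ∀ y ∉ F, coeff (p' j) y = 0 := fun j y hy => by rw [hp' j y, hF y hy, mul_zero]
  choose p'' hp'' using fun i j => isDeriv_of_finite_support (φ i) (hF' j)
  have hFH : ∀ y, y ∉ H → y ∉ F := fun y hy h => hy (AddSubgroup.subset_closure h)
  have hpH : p ∈ coeffOn H.toAddSubmonoid := fun y hy => hF y (hFH y hy)
  have hxH := inv_mem_coeffOn hpH hpx
  let q : Module.Basis.ofVectorSpaceIndex ℚ ℝ → GAlg := fun j => p' j * x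
  have hqH : ∀ j, q j ∈ coeffOn H.toAddSubmonoid := fun j =>
    mul_mem (fun y hy => hF' j y (hFH y hy)) hxH
  -- The integrability condition.
  have hcompat : ∀ i j y, (φ i y : ℂ) * coeff (q j) y = (φ j y : ℂ) * coeff (q i) y := by
    intro i j y
    have hd : ∀ i j, IsDeriv (φ i) (q j) (p'' i j * x + p' j * -(x * x * p' i)) := fun i j =>
      (hp'' i j).mul ((hp' i).inv hpx)
    rw [← hd i j y, ← hd j i y, coeff_add_apply, coeff_add_apply]
    have h1 : coeff (p'' i j) = coeff (p'' j i) := lp.ext (funext fun z => by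
      rw [hp'' i j z, hp'' j i z, hp' i z, hp' j z]
      ring)
    have h2 : p' j * -(x * x * p' i) = p' i * -(x * x * p' j) := by ring
    rw [coeff_mul_congr h1 rfl, h2]
  let m : Module.Basis.ofVectorSpaceIndex ℚ ℝ → ℝ → ℂ := fun j y =>
    if y ∈ H then ((φ j y / ∑ i ∈ J, φ i y ^ 2 : ℝ) : ℂ) else 0
  have hm : ∀ j ∈ J, ∀ y, ‖m j y‖ ≤ 1 := by
    intro j hj y
    by_cases hy : y ∈ H
    · have h1 : |φ j y| ≤ φ j y ^ 2 := by
        obtain ⟨n, hn⟩ := (hJ y hy).1 j hj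
        rw [hn]
        have h3 : |n| ≤ n ^ 2 := by
          rw [← sq_abs]
          exact Int.le_self_sq |n|
        exact_mod_cast h3
      have h2 : φ j y ^ 2 ≤ ∑ i ∈ J, φ i y ^ 2 :=
        Finset.single_le_sum (f := fun i => φ i y ^ 2) (fun i _ => sq_nonneg _) hj
      simp only [m, hy, if_true, Complex.norm_real, Real.norm_eq_abs, abs_div]
      rw [abs_of_nonneg (Finset.sum_nonneg fun i _ => sq_nonneg (φ i y))]
      exact div_le_one_of_le₀ (h1.trans h2) (Finset.sum_nonneg fun i _ => sq_nonneg _)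
    · simp [m, hy]
  let L : GAlg := ∑ j ∈ J.attach, mask (m j) (hm j j.2) (q j)
  have hLc : ∀ y, coeff L y = ∑ j ∈ J, m j y * coeff (q j) y := by
    intro y
    have h1 : coeffCLM y (coeff L) = ∑ j ∈ J.attach, m j y * coeff (q j) y := by
      simp only [L, map_sum]
      rfl
    rw [← coeffCLM_apply, h1]
    exact Finset.sum_attach J fun j => m j y * coeff (q j) y
  have hLH : L ∈ coeffOn H.toAddSubmonoid := by
    intro y hy
    rw [hLc]
    refine Finset.sum_eq_zero fun j _ => ?_
    rw [hqH j y hy, mul_zero]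
  have hLd : ∀ i ∈ J, IsDeriv (φ i) L (q i - coeff (q i) 0 • 1) := by
    intro i hi y
    rw [coeff_sub_apply, coeff_smul_apply, coeff_one_apply, hLc]
    by_cases hy0 : y = 0
    · subst hy0
      simp
    rw [if_neg hy0, mul_zero, sub_zero]
    by_cases hy : y ∈ H
    · have hne : ((∑ i ∈ J, φ i y ^ 2 : ℝ) : ℂ) ≠ 0 := by
        rw [Complex.ofReal_ne_zero]
        intro h0
        refine hy0 ((hJ y hy).2 fun j hj => ?_)
        exact pow_eq_zero_iff (two_ne_zero) |>.1
          ((Finset.sum_eq_zero_iff_of_nonneg fun i _ => sq_nonneg (φ i y)).1 h0 j hj)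
      rw [Finset.mul_sum]
      have h1 : ∀ j ∈ J, (φ i y : ℂ) * (m j y * coeff (q j) y) =
          ((φ j y : ℂ) ^ 2) * (coeff (q i) y / ((∑ i ∈ J, φ i y ^ 2 : ℝ) : ℂ)) := by
        intro j _
        simp only [m, hy, if_true, Complex.ofReal_div]
        linear_combination (φ j y : ℂ) / ((∑ i ∈ J, φ i y ^ 2 : ℝ) : ℂ) * hcompat i j y
      rw [Finset.sum_congr rfl h1, ← Finset.sum_mul]
      have h2 : ∑ j ∈ J, (φ j y : ℂ) ^ 2 = ((∑ i ∈ J, φ i y ^ 2 : ℝ) : ℂ) := by push_cast; rfl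
      rw [h2, mul_div_cancel₀ _ hne]
    · rw [hqH i y hy, Finset.sum_eq_zero fun j _ => by rw [hqH j y hy, mul_zero], mul_zero]
  let c : GAlg := p * NormedSpace.exp (-L)
  have hcd : ∀ i ∈ J, ∀ y, (φ i y : ℂ) * coeff c y = coeff (q i) 0 * coeff c y := by
    intro i hi y
    have h1 : IsDeriv (φ i) c (p' i * NormedSpace.exp (-L) +
        p * (NormedSpace.exp (-L) * -(q i - coeff (q i) 0 • 1))) :=
      (hp' i).mul (hLd i hi).neg.exp
    have h2 : p' i * NormedSpace.exp (-L) +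
        p * (NormedSpace.exp (-L) * -(q i - coeff (q i) 0 • 1)) = coeff (q i) 0 • c := by
      have h3 : coeff (q i) 0 • c = c * (coeff (q i) 0 • 1) := by
        rw [mul_smul_comm, mul_one]
      rw [h3]
      simp only [c, q]
      linear_combination (-p' i * NormedSpace.exp (-L)) * hpx
    rw [← h1 y, h2, coeff_smul_apply]
  have hcH : c ∈ coeffOn H.toAddSubmonoid :=
    mul_mem hpH (NormedSpace.exp_mem (R := ℂ) (isClosed_coeffOn _) (neg_mem hLH))
  have hexp : NormedSpace.exp (-L) * NormedSpace.exp L = 1 := by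
    rw [← NormedSpace.exp_add, neg_add_cancel, NormedSpace.exp_zero]
  obtain ⟨μ, hμ⟩ : ∃ μ, coeff c μ ≠ 0 := by
    by_contra! h0
    have h1 : apPart c = 0 := ext (lp.ext (funext h0)) rfl
    have h2 : c * (x * NormedSpace.exp L) = 1 := by
      simp only [c]
      linear_combination (NormedSpace.exp (-L) * NormedSpace.exp L) * hpx + hexp
    have h3 := congrArg apPart h2
    rw [map_mul, h1, zero_mul, map_one] at h3
    have h4 := congrArg (eval 0) h3
    rw [map_zero, eval_one] at h4
    exact zero_ne_one h4
  have hμH : μ ∈ H := by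
    by_contra h
    exact hμ (hcH μ h)
  have huniq : ∀ y, y ≠ μ → coeff c y = 0 := by
    intro y hy
    by_contra hcy
    have hyH : y ∈ H := by
      by_contra h
      exact hcy (hcH y h)
    refine hy (sub_eq_zero.1 ((hJ (y - μ) (H.sub_mem hyH hμH)).2 fun i hi => ?_))
    have h1 := mul_right_cancel₀ hcy (hcd i hi y)
    have h2 := mul_right_cancel₀ hμ (hcd i hi μ)
    rw [map_sub, sub_eq_zero]
    exact Complex.ofReal_injective (h1.trans h2.symm)
  have hc : apPart c = freq μ * (coeff c μ • 1) := by
    rw [mul_smul_comm, mul_one]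
    refine ext (lp.ext (funext fun y => ?_)) (by rw [map_smul]; exact (smul_zero _).symm)
    rw [coeff_apPart, coeff_smul_apply, freq, coeff_mk, lp.single_apply]
    by_cases hy : y = μ
    · subst hy; simp
    · simp [hy, huniq y hy]
  obtain ⟨f, hf⟩ := exists_exp_eq_smul hμ
  refine ⟨μ, f + apPart L, ?_⟩
  have hp : p = c * NormedSpace.exp L := by
    simp only [c]
    linear_combination (-p) * hexp
  rw [NormedSpace.exp_add, hf, ← apPart_exp, ← mul_assoc, ← hc, ← map_mul, ← hp]

/-- Bohr's theorem on the argument, for absolutely convergent series: an invertible almost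
periodic element is a single frequency times an exponential. -/
lemma apPart_eq_freq_mul_exp {a a' : GAlg} (h : a * a' = 1) :
    ∃ (μ : ℝ) (f : GAlg), apPart a = freq μ * NormedSpace.exp f := by
  have h1 : apPart a * apPart a' = 1 := by rw [← map_mul, h, map_one]
  have hcl : apPart a ∈ closure {p : GAlg | ∃ F : Finset ℝ, ∀ y ∉ F, coeff p y = 0} := by
    have hs := (coeff a).hasSum_single
    have hcont : Continuous fun c : EllOne => mk c 0 :=
      (WithLp.prod_continuous_toLp 1 EllOne LOne).comp (by fun_prop)
    have hlim := (hcont.tendsto (coeff a)).comp hs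
    refine mem_closure_of_tendsto hlim (Eventually.of_forall fun F => ⟨F, fun y hy => ?_⟩)
    simp only [Function.comp, coeff_mk]
    rw [← coeffCLM_apply, map_sum]
    refine Finset.sum_eq_zero fun x hx => ?_
    have hxy : y ≠ x := fun h => hy (h ▸ hx)
    rw [map_smul, coeffCLM_apply, lp.single_apply_ne _ _ _ hxy, smul_zero]
  obtain ⟨p, ⟨F, hF⟩, f, hf⟩ := exists_eq_mul_exp_of_mem_closure h1 hcl
  have hpx : p * (NormedSpace.exp f * apPart a') = 1 := by
    rw [← mul_assoc, ← hf, h1]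
  obtain ⟨μ, f', hf'⟩ := apPart_eq_freq_mul_exp_of_finite_support hpx hF
  refine ⟨μ, f' + apPart f, ?_⟩
  have h2 := congrArg apPart hf
  rw [map_mul, hf', apPart_exp] at h2
  have h3 : apPart (apPart a) = apPart a := rfl
  rw [NormedSpace.exp_add, ← mul_assoc, ← h2, h3]

/-! ### Reflection -/

/-- The reflection `t ↦ -t`, in terms of coefficients and densities. -/
noncomputable def reflect (a : GAlg) : GAlg :=
  mk (EllOne.of (fun x => coeff a (-x)) ((Equiv.neg ℝ).summable_iff.2 (coeff a).summable_norm))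
    (Lp.compMeasurePreservingₗᵢ ℂ (fun s : ℝ => -s) (Measure.measurePreserving_neg volume) (dens a))

lemma dens_reflect (a : GAlg) : (dens (reflect a) : ℝ → ℂ) =ᵐ[volume] fun s => dens a (-s) :=
  Lp.coeFn_compMeasurePreserving (dens a) (Measure.measurePreserving_neg volume)

lemma eval_reflect (t : ℝ) (a : GAlg) : eval t (reflect a) = eval (-t) a := by
  rw [eval_eq, eval_eq]
  congr 1
  · unfold apSum
    rw [← (Equiv.neg ℝ).tsum_eq]
    refine tsum_congr fun x => ?_
    change coeff a (- -x) * _ = _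
    rw [neg_neg, Equiv.neg_apply]
    push_cast
    ring_nf
  · rw [fourierInt_congr (dens_reflect a)]
    unfold fourierInt
    rw [← integral_neg_eq_self]
    refine integral_congr_ae (Eventually.of_forall fun s => ?_)
    simp only [neg_neg]
    push_cast
    ring_nf

lemma reflect_reflect (a : GAlg) : reflect (reflect a) = a :=
  eval_injective fun t => by rw [eval_reflect, eval_reflect, neg_neg]

lemma reflect_sub (a b : GAlg) : reflect (a - b) = reflect a - reflect b :=
  eval_injective fun t => by rw [eval_reflect, map_sub, map_sub, eval_reflect, eval_reflect]

lemma norm_reflect (a : GAlg) : ‖reflect a‖ = ‖a‖ := by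
  have h1 : ‖coeff (reflect a)‖ = ‖coeff a‖ := by
    rw [EllOne.norm_eq, EllOne.norm_eq]
    exact (Equiv.neg ℝ).tsum_eq fun y => ‖coeff a y‖
  have h2 : ‖dens (reflect a)‖ = ‖dens a‖ :=
    Lp.norm_compMeasurePreserving (dens a) (Measure.measurePreserving_neg volume)
  rw [norm_eq, norm_eq a, h1, h2]

lemma continuous_reflect : Continuous reflect := by
  refine (Isometry.of_dist_eq fun a b => ?_).continuous
  rw [dist_eq_norm, dist_eq_norm, ← reflect_sub, norm_reflect]

lemma reflect_mem_plus {a : GAlg} (ha : a ∈ minus) : reflect a ∈ plus := by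
  refine ⟨fun x hx => ?_, ?_⟩
  · exact ha.1 (-x) (notMem_leftHalf.2 (neg_pos.2 (notMem_rightHalf.1 hx)))
  · filter_upwards [dens_reflect a,
      (Measure.measurePreserving_neg (volume : Measure ℝ)).quasiMeasurePreserving.ae ha.2]
      with s h1 h2 hs
    rw [h1]
    exact h2 (notMem_leftHalf.2 (neg_pos.2 (notMem_rightHalf.1 hs)))

lemma reflect_mem_minus {a : GAlg} (ha : a ∈ plus) : reflect a ∈ minus := by
  refine ⟨fun x hx => ?_, ?_⟩
  · exact ha.1 (-x) (notMem_rightHalf.2 (neg_lt_zero.2 (notMem_leftHalf.1 hx)))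
  · filter_upwards [dens_reflect a,
      (Measure.measurePreserving_neg (volume : Measure ℝ)).quasiMeasurePreserving.ae ha.2]
      with s h1 h2 hs
    rw [h1]
    exact h2 (notMem_rightHalf.2 (neg_lt_zero.2 (notMem_leftHalf.1 hs)))

/-! ### Rational elements -/

/-- The one-sided exponential density `s ↦ e^{-iws}` on `(0, ∞)`, for `Im w < 0`, has Fourier
transform `i / (t - w)`. -/
lemma exists_oneSided_exp {w : ℂ} (hw : w.im < 0) : ∃ r : GAlg, coeff r = 0 ∧
    ((dens r : ℝ → ℂ) =ᵐ[volume]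
      (Set.Ioi (0 : ℝ)).indicator fun s : ℝ => Complex.exp (-Complex.I * w * s)) ∧
    ∀ t : ℝ, eval t r = Complex.I / (t - w) := by
  have hint : Integrable
      ((Set.Ioi (0 : ℝ)).indicator fun s : ℝ => Complex.exp (-Complex.I * w * s)) := by
    rw [integrable_indicator_iff measurableSet_Ioi]
    exact integrableOn_exp_mul_complex_Ioi (by simpa using hw) 0
  refine ⟨mk 0 (hint.toL1 _), rfl, Integrable.coeFn_toL1 hint, fun t => ?_⟩
  have h0 : apSum ((0 : EllOne) : ℝ → ℂ) t = 0 := map_zero (evalSum t)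
  rw [eval_mk, h0, zero_add, fourierInt_congr (Integrable.coeFn_toL1 hint)]
  have h1 : ∀ s : ℝ, ((Set.Ioi (0 : ℝ)).indicator (fun s : ℝ => Complex.exp (-Complex.I * w * s)) s)
      * Complex.exp (Complex.I * (s : ℂ) * (t : ℂ)) =
      (Set.Ioi (0 : ℝ)).indicator (fun s : ℝ => Complex.exp (Complex.I * (t - w) * s)) s := by
    intro s
    by_cases hs : s ∈ Set.Ioi (0 : ℝ)
    · rw [Set.indicator_of_mem hs, Set.indicator_of_mem hs, ← Complex.exp_add]
      ring_nf
    · rw [Set.indicator_of_notMem hs, Set.indicator_of_notMem hs, zero_mul]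
  have hre : (Complex.I * (t - w)).re < 0 := by simpa using hw
  have hne : (t : ℂ) - w ≠ 0 := by
    intro h
    have := congrArg Complex.im h
    simp at this
    exact hw.ne this
  simp only [fourierInt, h1]
  rw [integral_indicator measurableSet_Ioi, integral_exp_mul_complex_Ioi hre]
  field_simp
  simp

/-- The resolvent functions `1 / (t - w)`, for non-real `w`, are Fourier transforms. -/
lemma exists_resolvent {w : ℂ} (hw : w.im ≠ 0) : ∃ r : GAlg, coeff r = 0 ∧
    ∀ t : ℝ, eval t r = ((t : ℂ) - w)⁻¹ := by
  rcases lt_or_gt_of_ne hw with h | h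
  · obtain ⟨r, h1, -, h2⟩ := exists_oneSided_exp h
    refine ⟨(-Complex.I) • r, by rw [map_smul, h1, smul_zero], fun t => ?_⟩
    rw [map_smul, h2, smul_eq_mul, ← mul_div_assoc, neg_mul, Complex.I_mul_I, neg_neg, one_div]
  · obtain ⟨r, h1, -, h2⟩ := exists_oneSided_exp (w := -w) (by simpa using h)
    refine ⟨Complex.I • reflect r, ?_, fun t => ?_⟩
    · rw [map_smul]
      refine lp.ext (funext fun x => ?_)
      change Complex.I * coeff r (-x) = 0
      rw [h1]
      exact mul_zero _
    · rw [map_smul, eval_reflect, h2, smul_eq_mul, ← mul_div_assoc, Complex.I_mul_I]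
      push_cast
      rw [show -(t : ℂ) - -w = -(t - w) by ring, neg_div_neg_eq, one_div]

open Polynomial in
/-- The elements of the algebra that are given by a rational function vanishing at infinity. -/
noncomputable def rational : Submodule ℂ GAlg where
  carrier := {p | coeff p = 0 ∧ ∃ P Q : ℂ[X], P.degree < Q.degree ∧ (∀ t : ℝ, Q.eval (t : ℂ) ≠ 0) ∧
    ∀ t : ℝ, eval t p = P.eval (t : ℂ) / Q.eval (t : ℂ)}
  zero_mem' := ⟨map_zero _, 0, 1, by simp, by simp, by simp⟩
  add_mem' := by
    rintro p₁ p₂ ⟨h₁, P₁, Q₁, hd₁, hQ₁, hp₁⟩ ⟨h₂, P₂, Q₂, hd₂, hQ₂, hp₂⟩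
    refine ⟨by rw [map_add, h₁, h₂, add_zero], P₁ * Q₂ + P₂ * Q₁, Q₁ * Q₂, ?_, fun t => ?_,
      fun t => ?_⟩
    · have hb₁ : Q₁.degree ≠ ⊥ := (bot_le.trans_lt hd₁).ne'
      have hb₂ : Q₂.degree ≠ ⊥ := (bot_le.trans_lt hd₂).ne'
      refine (degree_add_le _ _).trans_lt (max_lt ?_ ?_)
      · rw [degree_mul, degree_mul]
        exact WithBot.add_lt_add_right hb₂ hd₁
      · rw [degree_mul, degree_mul, add_comm]
        exact WithBot.add_lt_add_left hb₁ hd₂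
    · rw [Polynomial.eval_mul]
      exact mul_ne_zero (hQ₁ t) (hQ₂ t)
    · rw [map_add, hp₁, hp₂, div_add_div _ _ (hQ₁ t) (hQ₂ t), Polynomial.eval_mul, eval_add,
        Polynomial.eval_mul, Polynomial.eval_mul, mul_comm (Q₁.eval _) (P₂.eval _)]
  smul_mem' := by
    rintro z p ⟨h, P, Q, hd, hQ, hp⟩
    refine ⟨by rw [map_smul, h, smul_zero], z • P, Q, (degree_smul_le _ _).trans_lt hd, hQ,
      fun t => ?_⟩
    rw [map_smul, hp, eval_smul, smul_eq_mul, smul_eq_mul, mul_div_assoc]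

open Polynomial in
lemma reflect_mem_rational {p : GAlg} (hp : p ∈ rational) : reflect p ∈ rational := by
  obtain ⟨h, P, Q, hd, hQ, hp⟩ := hp
  refine ⟨?_, P.comp (-X), Q.comp (-X), ?_, fun t => ?_, fun t => ?_⟩
  · refine lp.ext (funext fun x => ?_)
    change coeff p (-x) = 0
    rw [h]
    rfl
  · rwa [degree_comp_neg_X, degree_comp_neg_X]
  · rw [eval_comp, eval_neg, eval_X, ← Complex.ofReal_neg]
    exact hQ (-t)
  · rw [eval_reflect, hp, eval_comp, eval_comp, eval_neg, eval_X, Complex.ofReal_neg]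

open Polynomial in
lemma exists_rational_of_polynomial (q : ℂ[X]) : ∃ p ∈ rational,
    (dens p : ℝ → ℂ) =ᵐ[volume] (Set.Ioi (0 : ℝ)).indicator
      fun s : ℝ => (Real.exp (-s) : ℂ) * q.eval (Real.exp (-s) : ℂ) := by
  induction q using Polynomial.induction_on' with
  | add q₁ q₂ h₁ h₂ =>
    obtain ⟨p₁, hp₁, hd₁⟩ := h₁
    obtain ⟨p₂, hp₂, hd₂⟩ := h₂
    refine ⟨p₁ + p₂, add_mem hp₁ hp₂, ?_⟩
    rw [map_add]
    filter_upwards [hd₁, hd₂, Lp.coeFn_add (dens p₁) (dens p₂)] with s h1 h2 h3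
    rw [h3, Pi.add_apply, h1, h2]
    by_cases hs : s ∈ Set.Ioi (0 : ℝ)
    · simp only [Set.indicator_of_mem hs, eval_add, mul_add]
    · simp only [Set.indicator_of_notMem hs, add_zero]
  | monomial n z =>
    have hw : (-(n + 1 : ℂ) * Complex.I).im < 0 := by
      have h : (-(n + 1 : ℂ) * Complex.I).im = -((n : ℝ) + 1) := by simp
      rw [h]
      linarith [(n.cast_nonneg : (0 : ℝ) ≤ n)]
    obtain ⟨r, h1, h2, h3⟩ := exists_oneSided_exp hw
    refine ⟨z • r, Submodule.smul_mem _ z ⟨h1, C Complex.I, X - C (-(n + 1 : ℂ) * Complex.I), ?_,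
      fun t => ?_, fun t => ?_⟩, ?_⟩
    · rw [degree_X_sub_C]
      exact degree_C_le.trans_lt (by norm_num)
    · rw [eval_sub, eval_X, eval_C]
      intro h
      have := congrArg Complex.im h
      rw [Complex.sub_im, Complex.ofReal_im, zero_sub, Complex.zero_im, neg_eq_zero] at this
      exact hw.ne this
    · rw [h3, eval_C, eval_sub, eval_X, eval_C]
    · rw [map_smul]
      filter_upwards [h2, Lp.coeFn_smul z (dens r)] with s hs1 hs2
      rw [hs2, Pi.smul_apply, hs1]
      by_cases hs : s ∈ Set.Ioi (0 : ℝ)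
      · rw [Set.indicator_of_mem hs, Set.indicator_of_mem hs, eval_monomial, smul_eq_mul,
          mul_left_comm _ z, ← pow_succ', Complex.ofReal_exp, ← Complex.exp_nat_mul]
        congr 2
        push_cast
        linear_combination ((n : ℂ) + 1) * s * Complex.I_sq
      · rw [Set.indicator_of_notMem hs, Set.indicator_of_notMem hs, smul_zero]

/-- Weierstrass' theorem in the variable `x = e^{-s}`: exponential polynomials are close to a
given test function on the half-line, relative to `e^{-s}`. -/
lemma exists_polynomial_near_exp {g : ℝ → ℂ} (hg : Continuous g) (hg' : HasCompactSupport g)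
    {ε : ℝ} (hε : 0 < ε) : ∃ q : Polynomial ℂ, ∀ s : ℝ, 0 < s →
      ‖g s - (Real.exp (-s) : ℂ) * q.eval (Real.exp (-s) : ℂ)‖ ≤ ε * Real.exp (-s) := by
  obtain ⟨M, hM⟩ : ∃ M, ∀ s, M < s → g s = 0 := by
    obtain ⟨M, hM⟩ := hg'.isCompact.bddAbove
    exact ⟨M, fun s hs => image_eq_zero_of_notMem_tsupport fun h => hs.not_ge (hM h)⟩
  -- The junk values of `log` at negative arguments and of division at `0` make `φ` continuous.
  let φ : ℝ → ℂ := fun x => g (-Real.log x) / x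
  have hφ : Continuous φ := by
    rw [continuous_iff_continuousAt]
    intro x
    by_cases hx : x = 0
    · subst hx
      have h0 : φ =ᶠ[𝓝 0] fun _ => 0 := by
        filter_upwards [Metric.ball_mem_nhds (0 : ℝ) (Real.exp_pos (-M))] with y hy
        rw [Metric.mem_ball, dist_zero_right, Real.norm_eq_abs] at hy
        by_cases hy0 : y = 0
        · simp [φ, hy0]
        · have : Real.log y < -M := by
            rw [← Real.log_abs, Real.log_lt_iff_lt_exp (abs_pos.2 hy0)]
            exact hy
          simp only [φ]
          rw [hM _ (by linarith), zero_div]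
      exact continuousAt_const.congr h0.symm
    · have h1 : ContinuousAt (fun x => g (-Real.log x)) x :=
        hg.continuousAt.comp (Real.continuousAt_log hx).neg
      exact h1.div Complex.continuous_ofReal.continuousAt (Complex.ofReal_ne_zero.2 hx)
  obtain ⟨p₁, hp₁⟩ := exists_polynomial_near_of_continuousOn 0 1 (fun x => (φ x).re)
    (Complex.continuous_re.comp hφ).continuousOn (ε / 2) (half_pos hε)
  obtain ⟨p₂, hp₂⟩ := exists_polynomial_near_of_continuousOn 0 1 (fun x => (φ x).im)
    (Complex.continuous_im.comp hφ).continuousOn (ε / 2) (half_pos hε)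
  let q : Polynomial ℂ :=
    p₁.map Complex.ofRealHom + Polynomial.C Complex.I * p₂.map Complex.ofRealHom
  have hq : ∀ x : ℝ, q.eval (x : ℂ) = ((p₁.eval x : ℝ) : ℂ) + Complex.I * ((p₂.eval x : ℝ) : ℂ) := by
    intro x
    have h : ∀ p : Polynomial ℝ, (p.map Complex.ofRealHom).eval (x : ℂ) = ((p.eval x : ℝ) : ℂ) :=
      fun p => Polynomial.eval_map_apply (f := Complex.ofRealHom) x
    simp only [q, Polynomial.eval_add, Polynomial.eval_mul, Polynomial.eval_C, h]
  refine ⟨q, fun s hs => ?_⟩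
  have hx0 : (0 : ℝ) < Real.exp (-s) := Real.exp_pos _
  have hmem : Real.exp (-s) ∈ Set.Icc (0 : ℝ) 1 := ⟨hx0.le, Real.exp_le_one_iff.2 (by linarith)⟩
  have h1 : g s = (Real.exp (-s) : ℂ) * φ (Real.exp (-s)) := by
    simp only [φ]
    rw [Real.log_exp, neg_neg, mul_div_cancel₀ _ (Complex.ofReal_ne_zero.2 hx0.ne')]
  rw [h1, ← mul_sub, norm_mul, Complex.norm_real, Real.norm_eq_abs, abs_of_pos hx0, mul_comm]
  refine mul_le_mul_of_nonneg_right ?_ hx0.le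
  refine (Complex.norm_le_abs_re_add_abs_im _).trans ?_
  have h2 := hp₁ _ hmem
  have h3 := hp₂ _ hmem
  rw [abs_sub_comm] at h2 h3
  rw [hq]
  simp only [Complex.sub_re, Complex.sub_im, Complex.add_re, Complex.add_im, Complex.mul_re,
    Complex.mul_im, Complex.I_re, Complex.I_im, Complex.ofReal_re, Complex.ofReal_im]
  ring_nf at h2 h3 ⊢
  linarith

lemma sub_apPart_mem_closure_rational_of_plus {a : GAlg} (ha : a ∈ plus) :
    a - apPart a ∈ closure (rational : Set GAlg) := by
  rw [Metric.mem_closure_iff]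
  intro ε hε
  obtain ⟨g, hgs, hgi, hgc, hgint⟩ :=
    (L1.integrable_coeFn (dens a)).exists_hasCompactSupport_integral_sub_le
    (show 0 < ε / 3 by positivity)
  obtain ⟨q, hq⟩ := exists_polynomial_near_exp hgc hgs (show 0 < ε / 3 by positivity)
  obtain ⟨p, hp, hpd⟩ := exists_rational_of_polynomial q
  refine ⟨p, hp, ?_⟩
  have hc : coeff (a - apPart a - p) = 0 := by
    rw [map_sub, map_sub, coeff_apPart, hp.1, sub_self, sub_zero]
  have hd : dens (a - apPart a - p) = dens a - dens p := by
    rw [map_sub, map_sub, dens_apPart, sub_zero]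
  rw [dist_eq_norm, norm_eq, hc, hd, norm_zero, zero_add, L1.norm_eq_integral_norm]
  have hexp : Integrable ((Set.Ioi (0 : ℝ)).indicator fun s => Real.exp (-s)) := by
    rw [integrable_indicator_iff measurableSet_Ioi]
    exact integrableOn_exp_neg_Ioi 0
  have hag : Integrable fun s => ‖dens a s - g s‖ :=
    ((L1.integrable_coeFn (dens a)).sub hgint).norm
  have hb : Integrable fun s => ‖dens a s - g s‖ +
      ε / 3 * (Set.Ioi (0 : ℝ)).indicator (fun s => Real.exp (-s)) s :=
    hag.add (hexp.const_mul _)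
  have hle : ∫ s, ‖(dens a - dens p : LOne) s‖ ≤ ∫ s, (‖dens a s - g s‖ +
      ε / 3 * (Set.Ioi (0 : ℝ)).indicator (fun s => Real.exp (-s)) s) := by
    refine integral_mono_ae (L1.integrable_coeFn _).norm hb ?_
    filter_upwards [Lp.coeFn_sub (dens a) (dens p), hpd, ha.2, Measure.ae_ne volume (0 : ℝ)]
      with s h1 h2 h3 h4
    rw [h1, Pi.sub_apply, h2]
    rcases lt_or_gt_of_ne h4 with hs | hs
    · have hs' : s ∉ Set.Ioi (0 : ℝ) := fun h => lt_asymm hs h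
      rw [h3 (notMem_rightHalf.2 hs), Set.indicator_of_notMem hs', Set.indicator_of_notMem hs',
        sub_zero, norm_zero, mul_zero, add_zero]
      exact norm_nonneg _
    · have hs' : s ∈ Set.Ioi (0 : ℝ) := hs
      rw [Set.indicator_of_mem hs', Set.indicator_of_mem hs']
      refine (norm_sub_le_norm_sub_add_norm_sub _ (g s) _).trans ?_
      exact add_le_add le_rfl (hq s hs)
  refine hle.trans_lt ?_
  rw [integral_add hag (hexp.const_mul _),
    integral_const_mul, integral_indicator measurableSet_Ioi, integral_exp_neg_Ioi_zero]
  linarith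

/-- Rational functions are dense among the Fourier transforms of integrable functions. -/
lemma mem_closure_rational {a : GAlg} (ha : coeff a = 0) : a ∈ closure (rational : Set GAlg) := by
  obtain ⟨u, hu, v, hv, rfl⟩ := exists_add_eq a
  have h1 : u + v = (u - apPart u) + (v - apPart v) := by
    have : apPart (u + v) = 0 := by
      rw [← map_zero apPart, apPart_eq_iff, ha, map_zero]
    rw [map_add] at this
    linear_combination this
  have h2 : reflect (u - apPart u) ∈ closure (rational : Set GAlg) := by
    have h3 : reflect (apPart u) = apPart (reflect u) := by
      refine ext rfl ?_
      rw [dens_apPart]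
      exact map_zero (Lp.compMeasurePreservingₗᵢ ℂ _ _)
    rw [reflect_sub, h3]
    exact sub_apPart_mem_closure_rational_of_plus (reflect_mem_plus hu)
  have h4 : u - apPart u ∈ closure (rational : Set GAlg) := by
    rw [← reflect_reflect (u - apPart u)]
    exact map_mem_closure continuous_reflect h2 fun p hp => reflect_mem_rational hp
  rw [h1]
  exact rational.topologicalClosure.add_mem h4 (sub_apPart_mem_closure_rational_of_plus hv)

/-! ### Logarithms in the unital Wiener algebra -/

lemma ofReal_sub_ne_zero {w : ℂ} (hw : w.im ≠ 0) (t : ℝ) : (t : ℂ) - w ≠ 0 := by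
  intro h
  have := congrArg Complex.im h
  rw [Complex.sub_im, Complex.ofReal_im, zero_sub, Complex.zero_im, neg_eq_zero] at this
  exact hw this

lemma ofReal_sub_I_ne_zero (t : ℝ) : (t : ℂ) - Complex.I ≠ 0 := ofReal_sub_ne_zero (by simp) t

lemma ofReal_add_I_ne_zero (t : ℝ) : (t : ℂ) + Complex.I ≠ 0 := by
  have h := ofReal_sub_ne_zero (w := -Complex.I) (by simp) t
  rwa [sub_neg_eq_add] at h

lemma chi_ne_zero (t : ℝ) : chi t ≠ 0 :=
  div_ne_zero (ofReal_sub_I_ne_zero t) (ofReal_add_I_ne_zero t)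

lemma exists_exp_of_apPart_eq_one {f : GAlg} (h : apPart (NormedSpace.exp f) = 1) :
    ∃ κ : GAlg, coeff κ = 0 ∧ NormedSpace.exp κ = NormedSpace.exp f := by
  refine ⟨f - apPart f, by rw [map_sub, coeff_apPart, sub_self], ?_⟩
  have h1 : NormedSpace.exp (f - apPart f) * NormedSpace.exp (apPart f) = NormedSpace.exp f := by
    rw [← NormedSpace.exp_add, sub_add_cancel]
  rwa [← apPart_exp, h, mul_one] at h1

/-- The functions `χⁿ e^{κ}` with `n` an integer and `κ` the Fourier transform of an integrable
function. -/
def IsChiExp (h : ℝ → ℂ) : Prop :=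
  ∃ (n : ℤ) (κ : GAlg), coeff κ = 0 ∧ ∀ t, h t = chi t ^ n * Complex.exp (eval t κ)

lemma IsChiExp.mul {h₁ h₂ : ℝ → ℂ} (H₁ : IsChiExp h₁) (H₂ : IsChiExp h₂) :
    IsChiExp fun t => h₁ t * h₂ t := by
  obtain ⟨n₁, κ₁, hc₁, H₁⟩ := H₁
  obtain ⟨n₂, κ₂, hc₂, H₂⟩ := H₂
  refine ⟨n₁ + n₂, κ₁ + κ₂, by rw [map_add, hc₁, hc₂, add_zero], fun t => ?_⟩
  simp only [H₁, H₂]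
  rw [zpow_add₀ (chi_ne_zero t), map_add, Complex.exp_add]
  ring

lemma IsChiExp.inv {h : ℝ → ℂ} (H : IsChiExp h) : IsChiExp fun t => (h t)⁻¹ := by
  obtain ⟨n, κ, hc, H⟩ := H
  refine ⟨-n, -κ, by rw [map_neg, hc, neg_zero], fun t => ?_⟩
  simp only [H]
  rw [mul_inv, zpow_neg, map_neg, Complex.exp_neg]

lemma IsChiExp.one : IsChiExp fun _ => 1 :=
  ⟨0, 0, map_zero _, fun t => by rw [zpow_zero, map_zero, Complex.exp_zero, one_mul]⟩

/-- If `z` and `w` lie in the same open half-plane, then `(t - z) / (t - w)` is an exponential: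
move `z` to `w` along a segment. -/
lemma exists_exp_eq_div {z w : ℂ} (h : 0 < z.im * w.im) : ∃ κ : GAlg, coeff κ = 0 ∧
    ∀ t : ℝ, Complex.exp (eval t κ) = (t - z) / (t - w) := by
  have hw : w.im ≠ 0 := fun h0 => by rw [h0, mul_zero] at h; exact h.false
  obtain ⟨r, hr, hre⟩ := exists_resolvent hw
  have hunit : ∀ s ∈ Set.Icc (0 : ℝ) 1, IsUnit (1 - (s : ℂ) • ((z - w) • r)) := by
    intro s hs
    have hv : (w + s * (z - w)).im ≠ 0 := by
      have h1 : (w + s * (z - w)).im = (1 - s) * w.im + s * z.im := by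
        simp
        ring
      intro h0
      rw [h1] at h0
      have h2 : (1 - s) * w.im ^ 2 + s * (z.im * w.im) = 0 := by
        linear_combination w.im * h0
      have h3 : 0 < w.im ^ 2 := by positivity
      rcases hs.1.eq_or_lt with h4 | h4
      · rw [← h4] at h2
        linarith
      · have := mul_pos h4 h
        have := mul_nonneg (sub_nonneg.2 hs.2) h3.le
        linarith
    obtain ⟨r', -, hre'⟩ := exists_resolvent hv
    refine IsUnit.of_mul_eq_one (1 + ((s : ℂ) * (z - w)) • r') (eval_injective fun t => ?_)
    have h1 := ofReal_sub_ne_zero hw t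
    have h2 := ofReal_sub_ne_zero hv t
    simp only [eval_mul, map_sub, map_add, map_smul, eval_one, hre, hre', smul_eq_mul]
    field_simp
    ring
  obtain ⟨f, hf⟩ := exists_exp_eq_one_sub hunit
  have hap : apPart (NormedSpace.exp f) = 1 := by
    rw [hf, ← map_one apPart, apPart_eq_iff, map_sub, map_smul, hr, smul_zero, sub_zero,
      coeff_apPart]
  obtain ⟨κ, hκ, hκe⟩ := exists_exp_of_apPart_eq_one hap
  refine ⟨κ, hκ, fun t => ?_⟩
  have h1 := ofReal_sub_ne_zero hw t
  rw [← eval_exp, hκe, hf, map_sub, eval_one, map_smul, hre, smul_eq_mul]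
  field_simp
  ring

lemma isChiExp_linear {z : ℂ} (hz : z.im ≠ 0) :
    IsChiExp fun t => ((t : ℂ) - z) / (t + Complex.I) := by
  rcases lt_or_gt_of_ne hz with h | h
  · obtain ⟨κ, hκ, he⟩ := exists_exp_eq_div (z := z) (w := -Complex.I) (by simpa using h)
    refine ⟨0, κ, hκ, fun t => ?_⟩
    rw [zpow_zero, one_mul, he, sub_neg_eq_add]
  · obtain ⟨κ, hκ, he⟩ := exists_exp_eq_div (z := z) (w := Complex.I) (by simpa using h)
    refine ⟨1, κ, hκ, fun t => ?_⟩
    have h1 := ofReal_sub_I_ne_zero t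
    have h2 := ofReal_add_I_ne_zero t
    rw [zpow_one, he, chi]
    field_simp

open Polynomial in
lemma isChiExp_polynomial {P : ℂ[X]} (hP : ∀ t : ℝ, P.eval (t : ℂ) ≠ 0) :
    IsChiExp fun t => P.eval (t : ℂ) / (P.leadingCoeff * ((t : ℂ) + Complex.I) ^ P.natDegree) := by
  have hP0 : P ≠ 0 := by
    rintro rfl
    exact hP 0 (by simp)
  have hroots : ∀ z ∈ P.roots, z.im ≠ 0 := by
    intro z hz h0
    refine hP z.re ?_
    have : ((z.re : ℝ) : ℂ) = z := Complex.ext (by simp) (by simp [h0])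
    rw [this]
    exact isRoot_of_mem_roots hz
  have key : ∀ s : Multiset ℂ, (∀ z ∈ s, z.im ≠ 0) → IsChiExp fun t : ℝ =>
      (s.map fun z => (t : ℂ) - z).prod / ((t : ℂ) + Complex.I) ^ Multiset.card s := by
    intro s
    induction s using Multiset.induction with
    | empty =>
      intro _
      simpa using IsChiExp.one
    | cons z s ih =>
      intro hs
      have h := (isChiExp_linear (hs z (Multiset.mem_cons_self z s))).mul
        (ih fun w hw => hs w (Multiset.mem_cons_of_mem hw))
      convert h using 2 with t
      rw [Multiset.map_cons, Multiset.prod_cons, Multiset.card_cons, pow_succ', div_mul_div_comm]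
  have hsplit := IsAlgClosed.splits P
  convert key P.roots hroots using 2 with t
  rw [hsplit.eval_eq_prod_roots, ← hsplit.natDegree_eq_card_roots,
    mul_div_mul_left _ _ (leadingCoeff_ne_zero.2 hP0)]

/-- Wiener's factorization: an invertible element of the form `1 + k` with `k` a Fourier integral
is `χⁿ e^{κ}`. It is approximated by a rational function, which splits into linear factors. -/
lemma isChiExp_of_mul_eq_one {a a' : GAlg} (ha : coeff a = coeff 1) (h : a * a' = 1) :
    IsChiExp fun t => eval t a := by
  have hcl : a ∈ closure {p : GAlg | ∃ r ∈ rational, p = 1 + r} := by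
    have h1 : a - 1 ∈ closure (rational : Set GAlg) :=
      mem_closure_rational (by rw [map_sub, ha, sub_self])
    have h2 := map_mem_closure (f := fun r : GAlg => 1 + r) (by fun_prop) h1
      (t := {p : GAlg | ∃ r ∈ rational, p = 1 + r}) fun r hr => ⟨r, hr, rfl⟩
    simpa using h2
  obtain ⟨p, ⟨r, ⟨hrc, P, Q, hd, hQ, hr⟩, rfl⟩, f, hf⟩ := exists_eq_mul_exp_of_mem_closure h hcl
  have hap : apPart (NormedSpace.exp f) = 1 := by
    have h1 := congrArg apPart hf
    have h2 : apPart a = 1 := by rw [← map_one apPart, apPart_eq_iff, ha]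
    have h3 : apPart (1 + r) = 1 := by
      rw [← map_one apPart, apPart_eq_iff, map_add, hrc, add_zero, coeff_apPart]
    rw [map_mul, h2, h3, one_mul] at h1
    exact h1.symm
  obtain ⟨κ, hκ, hκe⟩ := exists_exp_of_apPart_eq_one hap
  have hp : ∀ t, eval t (1 + r) = (P + Q).eval (t : ℂ) / Q.eval (t : ℂ) := by
    intro t
    rw [map_add, eval_one, hr, Polynomial.eval_add, add_div, div_self (hQ t), add_comm]
  have hPQ : ∀ t : ℝ, (P + Q).eval (t : ℂ) ≠ 0 := by
    intro t h0
    have h1 := congrArg (eval t) h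
    rw [hf, eval_mul, eval_mul, hp, h0, zero_div, zero_mul, zero_mul, eval_one] at h1
    exact zero_ne_one h1
  have hlead := Polynomial.leadingCoeff_add_of_degree_lt hd
  have hdeg : (P + Q).natDegree = Q.natDegree :=
    Polynomial.natDegree_eq_of_degree_eq (Polynomial.degree_add_eq_right_of_degree_lt hd)
  have hQ0 : Q.leadingCoeff ≠ 0 := by
    rw [Polynomial.leadingCoeff_ne_zero]
    rintro rfl
    exact hQ 0 (by simp)
  have hE : IsChiExp fun t => Complex.exp (eval t κ) :=
    ⟨0, κ, hκ, fun t => by rw [zpow_zero, one_mul]⟩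
  convert ((isChiExp_polynomial hPQ).mul (isChiExp_polynomial hQ).inv).mul hE using 2 with t
  rw [hf, eval_mul, ← hκe, eval_exp, hp, hlead, hdeg, inv_div, div_mul_div_comm,
    mul_comm _ (Polynomial.eval (t : ℂ) Q), mul_div_mul_right]
  exact mul_ne_zero hQ0 (pow_ne_zero _ (ofReal_add_I_ne_zero t))

end GAlg

/-! ### Continuous arguments -/

lemma isContArg_im_of_eq_exp {f w : ℝ → ℂ} (hw : Continuous w)
    (hf : ∀ t, f t = Complex.exp (w t)) : IsContArg f fun t => (w t).im := by
  refine ⟨Complex.continuous_im.comp hw, fun t => ⟨by rw [hf]; exact Complex.exp_ne_zero _, ?_⟩⟩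
  rw [hf, Complex.norm_exp, Complex.ofReal_exp, ← Complex.exp_add, mul_comm Complex.I,
    Complex.re_add_im]

lemma IsContArg.eq_add_const {f : ℝ → ℂ} {θ₁ θ₂ : ℝ → ℝ} (h₁ : IsContArg f θ₁)
    (h₂ : IsContArg f θ₂) : ∃ C : ℝ, ∀ t, θ₁ t = θ₂ t + C := by
  have hint : ∀ t, ∃ n : ℤ, θ₁ t - θ₂ t = n * (2 * Real.pi) := by
    intro t
    have hne : (‖f t‖ : ℂ) ≠ 0 := Complex.ofReal_ne_zero.2 (norm_ne_zero_iff.2 (h₁.2 t).1)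
    have h := mul_left_cancel₀ hne ((h₁.2 t).2.symm.trans (h₂.2 t).2)
    obtain ⟨n, hn⟩ := Complex.exp_eq_exp_iff_exists_int.1 h
    refine ⟨n, Complex.ofReal_injective ?_⟩
    refine mul_left_cancel₀ Complex.I_ne_zero ?_
    push_cast
    linear_combination hn
  choose n hn using hint
  have h2π : (2 * Real.pi : ℝ) ≠ 0 := by positivity
  have hcont : Continuous n := by
    rw [Int.isClosedEmbedding_coe_real.isInducing.continuous_iff]
    have : (Int.cast : ℤ → ℝ) ∘ n = fun t => (θ₁ t - θ₂ t) / (2 * Real.pi) :=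
      funext fun t => by rw [Function.comp_apply, hn, mul_div_cancel_right₀ _ h2π]
    rw [this]
    exact (h₁.1.sub h₂.1).div_const _
  refine ⟨n 0 * (2 * Real.pi), fun t => ?_⟩
  rw [← PreconnectedSpace.constant inferInstance hcont (x := t), ← hn]
  ring

lemma chi_eq_exp (t : ℝ) :
    chi t = Complex.exp (Complex.I * ((Real.pi + 2 * Real.arctan t : ℝ) : ℂ)) := by
  have hc : Real.cos (Real.arctan t) ≠ 0 := (Real.cos_arctan_pos t).ne'
  have hs : Real.sin (Real.arctan t) = Real.cos (Real.arctan t) * t := by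
    have h := Real.tan_eq_sin_div_cos (Real.arctan t)
    rw [Real.tan_arctan] at h
    field_simp at h
    linarith
  have hsq : ((Real.cos (Real.arctan t) : ℝ) : ℂ) ^ 2 * (1 + (t : ℂ) ^ 2) = 1 := by
    have h := Real.sin_sq_add_cos_sq (Real.arctan t)
    rw [hs] at h
    have h' : Real.cos (Real.arctan t) ^ 2 * (1 + t ^ 2) = 1 := by linarith
    exact_mod_cast h'
  have he : Complex.exp (Complex.I * ((Real.pi + 2 * Real.arctan t : ℝ) : ℂ)) =
      -(Complex.exp ((Real.arctan t : ℂ) * Complex.I)) ^ 2 := by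
    rw [← Complex.exp_nat_mul, neg_eq_neg_one_mul, ← Complex.exp_pi_mul_I, ← Complex.exp_add]
    push_cast
    ring_nf
  rw [he, Complex.exp_mul_I, ← Complex.ofReal_cos, ← Complex.ofReal_sin, hs, chi,
    div_eq_iff (GAlg.ofReal_add_I_ne_zero t)]
  rw [Complex.ofReal_mul]
  generalize ((Real.cos (Real.arctan t) : ℝ) : ℂ) = c at hsq ⊢
  linear_combination (Complex.I - t) * hsq +
    (c ^ 2 * (2 * t + (t : ℂ) ^ 2 * Complex.I + t ^ 3)) * Complex.I_sq

lemma tendsto_fourierInt (k : ℝ → ℂ) : Tendsto (fourierInt k) (cocompact ℝ) (𝓝 0) := by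
  have h := Real.tendsto_integral_exp_smul_cocompact k
  have h2π : (-(2 * Real.pi)⁻¹ : ℝ) ≠ 0 := by
    have := Real.pi_pos
    rw [neg_ne_zero]
    positivity
  have hc : Tendsto (fun t : ℝ => t * (-(2 * Real.pi)⁻¹)) (cocompact ℝ) (cocompact ℝ) :=
    (Homeomorph.mulRight₀ _ h2π).isClosedEmbedding.tendsto_cocompact
  refine (h.comp hc).congr fun t => ?_
  simp only [Function.comp, fourierInt]
  refine integral_congr_ae (Eventually.of_forall fun s => ?_)
  simp only [Circle.smul_def, Real.fourierChar_apply, smul_eq_mul]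
  rw [mul_comm]
  congr 2
  have hπ : (Real.pi : ℂ) ≠ 0 := Complex.ofReal_ne_zero.2 Real.pi_ne_zero
  push_cast
  field_simp

namespace GAlg

/-! ### The mean motion and the index -/

lemma norm_eval_le (t : ℝ) (a : GAlg) : ‖eval t a‖ ≤ ‖a‖ := by
  rw [eval_eq, norm_eq]
  refine (norm_add_le _ _).trans (add_le_add (norm_apSum_le _ t) ?_)
  rw [L1.norm_eq_integral_norm]
  exact norm_fourierInt_le _ t

/-- The decomposition of a function of `G` into its almost periodic part and a Fourier integral
is unique. -/
lemma eval_apPart_of_eq_add {g b k : ℝ → ℂ} {x : GAlg} (hg : ∀ t, g t = eval t x) (hb : b ∈ APw)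
    (hk : k ∈ L0) (h : g = b + k) : ∀ t, b t = eval t (apPart x) := by
  obtain ⟨u, hu, hbu⟩ := mem_APw_iff.1 hb
  obtain ⟨v, hv, hkv⟩ := mem_L0_iff.1 hk
  have hx : x = u + v := eval_injective fun t => by
    rw [← hg, h, map_add, ← hbu, ← hkv, Pi.add_apply]
  have hau : apPart x = u := by
    refine ext ?_ (by rw [dens_apPart, hu])
    rw [coeff_apPart, hx, map_add, hv, add_zero]
  rw [hau]
  exact hbu

lemma exists_decomposition {g : ℝ → ℂ} {x x' : GAlg} (hg : ∀ t, g t = eval t x)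
    (hx : x * x' = 1) : ∃ b ∈ APw, ∃ k ∈ L0, g = b + k ∧ InvertibleIn APw b := by
  have h1 : ∀ t, eval t (apPart x) * eval t (apPart x') = 1 := fun t => by
    rw [← eval_mul, ← map_mul, hx, map_one, eval_one]
  refine ⟨fun t => eval t (apPart x), mem_APw_iff.2 ⟨_, dens_apPart x, fun _ => rfl⟩,
    fun t => eval t (x - apPart x), mem_L0_iff.2 ⟨_, ?_, fun _ => rfl⟩, ?_, ?_, ?_, ?_⟩
  · rw [map_sub, coeff_apPart, sub_self]
  · funext t
    rw [hg, Pi.add_apply, map_sub, add_sub_cancel]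
  · exact fun t => left_ne_zero_of_mul_eq_one (h1 t)
  · exact mem_APw_iff.2 ⟨_, dens_apPart x, fun _ => rfl⟩
  · refine mem_APw_iff.2 ⟨apPart x', dens_apPart x', fun t => ?_⟩
    rw [Pi.inv_apply, inv_eq_of_mul_eq_one_right (h1 t)]

lemma isNu_iff {g : ℝ → ℂ} {x x' β : GAlg} {ν : ℝ} (hg : ∀ t, g t = eval t x) (hx : x * x' = 1)
    (hβ : apPart x = freq ν * NormedSpace.exp β) (y : ℝ) : IsNu g y ↔ y = ν := by
  let w : ℝ → ℂ := fun t => Complex.I * (ν : ℂ) * (t : ℂ) + eval t β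
  have hw : Continuous w := by
    have := continuous_eval β
    fun_prop
  have hexp : ∀ t, eval t (apPart x) = Complex.exp (w t) := fun t => by
    rw [hβ, eval_mul, eval_freq, eval_exp, ← Complex.exp_add]
  have hlim : ∀ {b : ℝ → ℂ} {θ : ℝ → ℝ}, (∀ t, b t = eval t (apPart x)) → IsContArg b θ →
      Tendsto (fun l : ℝ => (θ l - θ (-l)) / (2 * l)) atTop (𝓝 ν) := by
    intro b θ hb hθ
    obtain ⟨C, hC⟩ := hθ.eq_add_const
      (isContArg_im_of_eq_exp hw fun t => (hb t).trans (hexp t))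
    have hbound : Tendsto (fun l : ℝ => ((eval l β).im - (eval (-l) β).im) / (2 * l)) atTop
        (𝓝 0) := by
      have h2 : Tendsto (fun l : ℝ => ‖β‖ / l) atTop (𝓝 0) :=
        tendsto_const_nhds.div_atTop tendsto_id
      refine squeeze_zero_norm' ?_ h2
      filter_upwards [eventually_gt_atTop 0] with l hl
      rw [norm_div, Real.norm_eq_abs, Real.norm_eq_abs, abs_of_pos (show 0 < 2 * l by positivity),
        div_le_div_iff₀ (by positivity) hl]
      have h3 := (Complex.abs_im_le_norm _).trans (norm_eval_le l β)
      have h4 := (Complex.abs_im_le_norm _).trans (norm_eval_le (-l) β)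
      have h5 := abs_sub (eval l β).im (eval (-l) β).im
      nlinarith
    have h6 := hbound.const_add ν
    rw [add_zero] at h6
    refine h6.congr' ?_
    filter_upwards [eventually_gt_atTop 0] with l hl
    rw [hC, hC]
    simp only [w]
    have him : ∀ t : ℝ, (Complex.I * (ν : ℂ) * (t : ℂ) + eval t β).im = ν * t + (eval t β).im :=
      fun t => by simp
    rw [him, him]
    field_simp
    ring
  constructor
  · rintro ⟨b, hb, k, hk, hgbk, -, θ, hθ, hy⟩
    exact tendsto_nhds_unique hy (hlim (eval_apPart_of_eq_add hg hb hk hgbk) hθ)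
  · rintro rfl
    obtain ⟨b, hb, k, hk, hgbk, hinv⟩ := exists_decomposition hg hx
    have hb' := eval_apPart_of_eq_add hg hb hk hgbk
    have hθ := isContArg_im_of_eq_exp hw fun t => (hb' t).trans (hexp t)
    exact ⟨b, hb, k, hk, hgbk, hinv, _, hθ, hlim hb' hθ⟩

lemma isN_iff {g : ℝ → ℂ} {x x' κ : GAlg} {n : ℤ} (hg : ∀ t, g t = eval t x) (hx : x * x' = 1)
    (hκ : coeff κ = 0)
    (hn : ∀ t, eval t x = eval t (apPart x) * (chi t ^ n * Complex.exp (eval t κ))) (m : ℤ) :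
    IsN g m ↔ m = n := by
  let w : ℝ → ℂ := fun t =>
    Complex.I * ((n * (Real.pi + 2 * Real.arctan t) : ℝ) : ℂ) + eval t κ
  have hw : Continuous w := by
    have := continuous_eval κ
    have := Real.continuous_arctan
    fun_prop
  have hexp : ∀ t, chi t ^ n * Complex.exp (eval t κ) = Complex.exp (w t) := fun t => by
    rw [chi_eq_exp, ← Complex.exp_int_mul, ← Complex.exp_add]
    simp only [w]
    push_cast
    ring_nf
  have hκ0 : Tendsto (fun t => eval t κ) (cocompact ℝ) (𝓝 0) := by
    refine (tendsto_fourierInt (dens κ)).congr fun t => ?_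
    have h0 : apSum ((0 : EllOne) : ℝ → ℂ) t = 0 := map_zero (evalSum t)
    rw [eval_eq, hκ, h0, zero_add]
  have hκim : Tendsto (fun t => (eval t κ).im) (cocompact ℝ) (𝓝 0) :=
    (Complex.continuous_im.tendsto 0).comp hκ0
  have hwim : ∀ t, (w t).im = n * (Real.pi + 2 * Real.arctan t) + (eval t κ).im := fun t => by
    simp only [w]
    rw [Complex.add_im, Complex.I_mul_im, Complex.ofReal_re]
  have hquot : ∀ {b k : ℝ → ℂ}, b ∈ APw → k ∈ L0 → g = b + k → InvertibleIn APw b →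
      ∀ t, (1 + b⁻¹ * k) t = Complex.exp (w t) := by
    intro b k hb hk hgbk hinv t
    have hb' := eval_apPart_of_eq_add hg hb hk hgbk
    have h2 := hinv.1 t
    have h3 : b t + k t = b t * Complex.exp (w t) := by
      rw [← hexp, hb' t, ← hn, ← hg, hgbk, Pi.add_apply, hb' t]
    simp only [Pi.add_apply, Pi.one_apply, Pi.mul_apply, Pi.inv_apply]
    field_simp
    exact h3
  have hlim : ∀ {b k : ℝ → ℂ} {θ : ℝ → ℝ}, b ∈ APw → k ∈ L0 → g = b + k → InvertibleIn APw b →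
      IsContArg (1 + b⁻¹ * k) θ → ∃ C : ℝ, Tendsto θ atTop (𝓝 (n * (2 * Real.pi) + C)) ∧
        Tendsto θ atBot (𝓝 C) := by
    intro b k θ hb hk hgbk hinv hθ
    have h1 := hquot hb hk hgbk hinv
    obtain ⟨C, hC⟩ := hθ.eq_add_const (isContArg_im_of_eq_exp hw h1)
    have hθ' : θ = fun t => n * (Real.pi + 2 * Real.arctan t) + (eval t κ).im + C :=
      funext fun t => by rw [hC, hwim]
    refine ⟨C, ?_, ?_⟩
    · have h4 := ((((Real.tendsto_arctan_atTop.mono_right nhdsWithin_le_nhds).const_mul 2).const_add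
        Real.pi).const_mul (n : ℝ)).add (hκim.mono_left atTop_le_cocompact) |>.add_const C
      rw [hθ']
      convert h4 using 2
      ring
    · have h4 := ((((Real.tendsto_arctan_atBot.mono_right nhdsWithin_le_nhds).const_mul 2).const_add
        Real.pi).const_mul (n : ℝ)).add (hκim.mono_left atBot_le_cocompact) |>.add_const C
      rw [hθ']
      convert h4 using 2
      ring
  constructor
  · rintro ⟨b, hb, k, hk, hgbk, hinv, θ, hθ, A, B, hA, hB, hAB⟩
    obtain ⟨C, h1, h2⟩ := hlim hb hk hgbk hinv hθ
    rw [tendsto_nhds_unique hA h1, tendsto_nhds_unique hB h2, add_sub_cancel_right, mul_comm] at hAB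
    have h2π : (2 * Real.pi : ℝ) ≠ 0 := by positivity
    exact_mod_cast (mul_left_cancel₀ h2π hAB).symm
  · rintro rfl
    obtain ⟨b, hb, k, hk, hgbk, hinv⟩ := exists_decomposition hg hx
    have h1 := hquot hb hk hgbk hinv
    have hθ := isContArg_im_of_eq_exp hw h1
    obtain ⟨C, h4, h5⟩ := hlim hb hk hgbk hinv hθ
    exact ⟨b, hb, k, hk, hgbk, hinv, _, hθ, _, _, h4, h5, by ring⟩

/-! ### Wiener–Hopf factorization -/

/-- Every invertible element of `G` is of the form `e^{iνt} e^{β} χⁿ e^{κ}`, the first two factors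
being its almost periodic part. -/
lemma exists_log {x x' : GAlg} (hx : x * x' = 1) : ∃ (ν : ℝ) (n : ℤ) (β κ : GAlg),
    apPart x = freq ν * NormedSpace.exp β ∧ coeff κ = 0 ∧
    ∀ t, eval t x = eval t (apPart x) * (chi t ^ n * Complex.exp (eval t κ)) := by
  obtain ⟨ν, β, hβ⟩ := apPart_eq_freq_mul_exp hx
  have hap : apPart x * apPart x' = 1 := by rw [← map_mul, hx, map_one]
  have h1 : (x * apPart x') * (x' * apPart x) = 1 := by
    linear_combination (apPart x * apPart x') * hx + hap
  have h2 : coeff (x * apPart x') = coeff 1 := by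
    rw [← apPart_eq_iff, map_mul, map_one]
    exact hap
  obtain ⟨n, κ, hκ, h⟩ := isChiExp_of_mul_eq_one h2 h1
  refine ⟨ν, n, β, κ, hβ, hκ, fun t => ?_⟩
  rw [← h, ← eval_mul]
  congr 1
  linear_combination (-x) * hap

lemma invertibleIn_Gminus_iff {f : ℝ → ℂ} : InvertibleIn Gminus f ↔
    ∃ x ∈ minus, ∃ x' ∈ minus, x * x' = 1 ∧ ∀ t, f t = eval t x := by
  constructor
  · rintro ⟨h0, h1, h2⟩
    obtain ⟨x, hx, hf⟩ := mem_Gminus_iff.1 h1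
    obtain ⟨x', hx', hf'⟩ := mem_Gminus_iff.1 h2
    refine ⟨x, hx, x', hx', eval_injective fun t => ?_, hf⟩
    rw [eval_mul, ← hf, ← hf', eval_one, Pi.inv_apply, mul_inv_cancel₀ (h0 t)]
  · rintro ⟨x, hx, x', hx', h, hf⟩
    have h1 : ∀ t, f t * eval t x' = 1 := fun t => by rw [hf, ← eval_mul, h, eval_one]
    refine ⟨fun t => left_ne_zero_of_mul_eq_one (h1 t), mem_Gminus_iff.2 ⟨x, hx, hf⟩,
      mem_Gminus_iff.2 ⟨x', hx', fun t => ?_⟩⟩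
    rw [Pi.inv_apply, inv_eq_of_mul_eq_one_right (h1 t)]

lemma invertibleIn_Gplus_iff {f : ℝ → ℂ} : InvertibleIn Gplus f ↔
    ∃ x ∈ plus, ∃ x' ∈ plus, x * x' = 1 ∧ ∀ t, f t = eval t x := by
  constructor
  · rintro ⟨h0, h1, h2⟩
    obtain ⟨x, hx, hf⟩ := mem_Gplus_iff.1 h1
    obtain ⟨x', hx', hf'⟩ := mem_Gplus_iff.1 h2
    refine ⟨x, hx, x', hx', eval_injective fun t => ?_, hf⟩
    rw [eval_mul, ← hf, ← hf', eval_one, Pi.inv_apply, mul_inv_cancel₀ (h0 t)]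
  · rintro ⟨x, hx, x', hx', h, hf⟩
    have h1 : ∀ t, f t * eval t x' = 1 := fun t => by rw [hf, ← eval_mul, h, eval_one]
    refine ⟨fun t => left_ne_zero_of_mul_eq_one (h1 t), mem_Gplus_iff.2 ⟨x, hx, hf⟩,
      mem_Gplus_iff.2 ⟨x', hx', fun t => ?_⟩⟩
    rw [Pi.inv_apply, inv_eq_of_mul_eq_one_right (h1 t)]

lemma exp_mul_exp_neg (a : GAlg) : NormedSpace.exp a * NormedSpace.exp (-a) = 1 := by
  rw [← NormedSpace.exp_add, add_neg_cancel, NormedSpace.exp_zero]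

lemma reflect_mul (a b : GAlg) : reflect (a * b) = reflect a * reflect b :=
  eval_injective fun t => by rw [eval_mul, eval_reflect, eval_reflect, eval_reflect, eval_mul]

lemma reflect_one : reflect 1 = 1 :=
  eval_injective fun t => by rw [eval_reflect, eval_one, eval_one]

lemma invertibleIn_Gminus_tilde {f : ℝ → ℂ} (h : InvertibleIn Gplus f) :
    InvertibleIn Gminus (tilde f) := by
  obtain ⟨x, hx, x', hx', hxx, hf⟩ := invertibleIn_Gplus_iff.1 h
  refine invertibleIn_Gminus_iff.2 ⟨reflect x, reflect_mem_minus hx, reflect x',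
    reflect_mem_minus hx', by rw [← reflect_mul, hxx, reflect_one], fun t => ?_⟩
  rw [eval_reflect]
  exact hf (-t)

/-- A function which is a quotient of functions invertible in `G⁻`, and also of functions
invertible in `G⁺`, is constant. -/
lemma eq_of_mul_eq_mul {u₁ u₂ v₁ v₂ : ℝ → ℂ} (hu₁ : InvertibleIn Gminus u₁)
    (hu₂ : InvertibleIn Gminus u₂) (hv₁ : InvertibleIn Gplus v₁) (hv₂ : InvertibleIn Gplus v₂)
    (h : ∀ t, u₁ t * v₁ t = u₂ t * v₂ t) (t : ℝ) : u₁ t * u₂ 0 = u₁ 0 * u₂ t := by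
  obtain ⟨x₁, hx₁, -, -, -, hux₁⟩ := invertibleIn_Gminus_iff.1 hu₁
  obtain ⟨x₂, hx₂, x₂', hx₂', hxx₂, hux₂⟩ := invertibleIn_Gminus_iff.1 hu₂
  obtain ⟨y₁, hy₁, y₁', hy₁', hyy₁, hvy₁⟩ := invertibleIn_Gplus_iff.1 hv₁
  obtain ⟨y₂, hy₂, -, -, -, hvy₂⟩ := invertibleIn_Gplus_iff.1 hv₂
  have h1 : x₁ * y₁ = x₂ * y₂ := eval_injective fun s => by
    rw [eval_mul, eval_mul, ← hux₁, ← hux₂, ← hvy₁, ← hvy₂, h]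
  have h2 : x₁ * x₂' = y₂ * y₁' := by
    linear_combination (x₂' * y₁') * h1 - (x₁ * x₂') * hyy₁ + (y₂ * y₁') * hxx₂
  have h3 : x₁ * x₂' ∈ plus := h2 ▸ mul_mem hy₂ hy₁'
  have h4 : ∀ s, u₁ s = coeff (x₁ * x₂') 0 * u₂ s := fun s => by
    rw [← eval_eq_of_mem_minus_of_mem_plus (mul_mem hx₁ hx₂') h3 s, hux₁, hux₂, ← eval_mul]
    congr 1
    linear_combination (-x₁) * hxx₂
  rw [h4 t, h4 0]
  ring

lemma chi_neg (t : ℝ) : chi (-t) = (chi t)⁻¹ := by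
  have h1 := ofReal_sub_I_ne_zero t
  have h2 := ofReal_add_I_ne_zero t
  rw [chi, chi, inv_div, Complex.ofReal_neg, show -(t : ℂ) - Complex.I = -(t + Complex.I) by ring,
    show -(t : ℂ) + Complex.I = -(t - Complex.I) by ring, neg_div_neg_eq]

lemma chi_zero : chi 0 = -1 := by
  rw [chi, Complex.ofReal_zero, zero_sub, zero_add, neg_div, div_self Complex.I_ne_zero]

/-- The middle factor `e^{iνt} χ(t)ⁿ` is inverted by the reflection. -/
lemma middle_mul_middle_neg (ν : ℝ) (n : ℤ) (t : ℝ) :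
    Complex.exp (Complex.I * (ν : ℂ) * (t : ℂ)) * chi t ^ n *
      (Complex.exp (Complex.I * (ν : ℂ) * ((-t : ℝ) : ℂ)) * chi (-t) ^ n) = 1 := by
  have h1 : Complex.exp (Complex.I * (ν : ℂ) * (t : ℂ)) *
      Complex.exp (Complex.I * (ν : ℂ) * ((-t : ℝ) : ℂ)) = 1 := by
    rw [← Complex.exp_add]
    simp
  have h2 : chi t ^ n * chi (-t) ^ n = 1 := by
    rw [← mul_zpow, chi_neg, mul_inv_cancel₀ (chi_ne_zero t), one_zpow]
  linear_combination (chi t ^ n * chi (-t) ^ n) * h1 + h2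

lemma exists_isWHFactorization {g : ℝ → ℂ} {x β κ : GAlg} (hg : ∀ t, g t = eval t x)
    (hβ : apPart x = freq (nu g) * NormedSpace.exp β)
    (hn : ∀ t, eval t x = eval t (apPart x) * (chi t ^ ind g * Complex.exp (eval t κ))) :
    ∃ gm gp, IsWHFactorization g gm gp ∧ gm 0 = 1 := by
  obtain ⟨u, hu, v, hv, huv⟩ := exists_add_eq (β + κ)
  -- The constant `eval 0 u` is moved from one summand to the other to get `g₋(0) = 1`.
  have hum : u - eval 0 u • (1 : GAlg) ∈ minus :=
    sub_mem hu (Subalgebra.smul_mem _ (one_mem _) _)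
  have hvp : v + eval 0 u • (1 : GAlg) ∈ plus :=
    add_mem hv (Subalgebra.smul_mem _ (one_mem _) _)
  refine ⟨fun t => eval t (NormedSpace.exp (u - eval 0 u • (1 : GAlg))),
    fun t => eval t (NormedSpace.exp (v + eval 0 u • (1 : GAlg))), ⟨?_, ?_, fun t => ?_⟩, ?_⟩
  · exact invertibleIn_Gminus_iff.2 ⟨_, exp_mem_minus hum, _, exp_mem_minus (neg_mem hum),
      exp_mul_exp_neg _, fun _ => rfl⟩
  · exact invertibleIn_Gplus_iff.2 ⟨_, exp_mem_plus hvp, _, exp_mem_plus (neg_mem hvp),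
      exp_mul_exp_neg _, fun _ => rfl⟩
  · have h1 : Complex.exp (eval t β) * Complex.exp (eval t κ) =
        eval t (NormedSpace.exp (u - eval 0 u • (1 : GAlg))) *
          eval t (NormedSpace.exp (v + eval 0 u • (1 : GAlg))) := by
      rw [eval_exp, eval_exp, ← Complex.exp_add, ← Complex.exp_add, ← map_add, ← map_add, ← huv]
      congr 2
      abel
    rw [hg, hn, hβ, eval_mul, eval_freq, eval_exp]
    linear_combination (Complex.exp (Complex.I * (nu g : ℂ) * (t : ℂ)) * chi t ^ ind g) * h1
  · simp only [eval_exp, map_sub, map_smul, eval_one, smul_eq_mul, mul_one, sub_self,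
      Complex.exp_zero]

lemma isWHFactorization_unique {g gm gp hm hp : ℝ → ℂ} (h₁ : IsWHFactorization g gm gp)
    (h₂ : IsWHFactorization g hm hp) (h₁0 : gm 0 = 1) (h₂0 : hm 0 = 1) : gm = hm ∧ gp = hp := by
  have h : ∀ t, gm t * gp t = hm t * hp t := by
    intro t
    have h3 := (h₁.2.2 t).symm.trans (h₂.2.2 t)
    refine mul_left_cancel₀ (left_ne_zero_of_mul_eq_one (middle_mul_middle_neg (nu g) (ind g) t)) ?_
    linear_combination h3
  have hgm : gm = hm := by
    funext t
    have h4 := eq_of_mul_eq_mul h₁.1 h₂.1 h₁.2.1 h₂.2.1 h t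
    rwa [h₁0, h₂0, one_mul, mul_one] at h4
  refine ⟨hgm, funext fun t => mul_left_cancel₀ (h₁.1.1 t) ?_⟩
  rw [h, hgm]

/-- Reflecting a factorization of `g` and inverting gives a second factorization, because
`g (-t) = 1 / g t`; comparing the two determines `g₋` in terms of `g₊`. -/
lemma isWHFactorization_minus_eq {g gm gp : ℝ → ℂ} (hmatch : ∀ t, g t * g (-t) = 1)
    (h : IsWHFactorization g gm gp) (t : ℝ) : gm t = xi g * (tilde gp t)⁻¹ := by
  have htp := invertibleIn_Gminus_tilde h.2.1
  have hprod : ∀ s, gm s * tilde gp s * (gp s * gm (-s)) = 1 := by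
    intro s
    have h1 := hmatch s
    rw [h.2.2 s, h.2.2 (-s)] at h1
    rw [tilde]
    linear_combination h1 - (gm s * gp (-s) * (gp s * gm (-s))) *
      middle_mul_middle_neg (nu g) (ind g) s
  obtain ⟨x, hx, x', hx', hxx, hgx⟩ := invertibleIn_Gminus_iff.1 h.1
  obtain ⟨y, hy, y', hy', hyy, hgy⟩ := invertibleIn_Gplus_iff.1 h.2.1
  have h2 : (x * reflect y) * (y * reflect x) = 1 := eval_injective fun s => by
    have h3 := hprod s
    rw [hgx, hgx, hgy, tilde, hgy] at h3
    rw [eval_mul, eval_mul, eval_mul, eval_reflect, eval_reflect, eval_one, h3]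
  have h4 : x * reflect y = y' * reflect x' := by
    have h5 : reflect x * reflect x' = 1 := by rw [← reflect_mul, hxx, reflect_one]
    linear_combination (y' * reflect x') * h2 - (x * reflect y * reflect x * reflect x') * hyy -
      (x * reflect y) * h5
  have h6 : x * reflect y ∈ plus := h4 ▸ mul_mem hy' (reflect_mem_plus hx')
  have h7 := eval_eq_of_mem_minus_of_mem_plus (mul_mem hx (reflect_mem_minus hy)) h6
  have h8 : gm t * tilde gp t = gm 0 * gp 0 := by
    have h9 := (h7 t).trans (h7 0).symm
    rw [eval_mul, eval_mul, eval_reflect, eval_reflect, ← hgx, ← hgx, ← hgy, ← hgy, neg_zero] at h9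
    exact h9
  have h10 : xi g = gm 0 * gp 0 := by
    have h11 : ((-1 : ℂ) ^ ind g) * (-1) ^ ind g = 1 := by
      rw [← mul_zpow, neg_one_mul, neg_neg, one_zpow]
    rw [xi, h.2.2 0, chi_zero, Complex.ofReal_zero, mul_zero, Complex.exp_zero]
    linear_combination (gm 0 * gp 0) * h11
  rw [h10, ← h8, mul_inv_cancel_right₀ (htp.1 t)]

end GAlg

end WienerHopf

theorem theorem3 (g : ℝ → ℂ) (hg : g ∈ WienerHopf.G) (hmatch : g * WienerHopf.tilde g = 1) :
    -- `ν(g)` and `n(g)` are well defined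
    (∀ x : ℝ, WienerHopf.IsNu g x ↔ x = WienerHopf.nu g) ∧
    (∀ m : ℤ, WienerHopf.IsN g m ↔ m = WienerHopf.ind g) ∧
    (WienerHopf.xi g = 1 ∨ WienerHopf.xi g = -1) ∧
    -- the factorization exists, and is unique under the normalization `g₋(0) = 1`
    (∃! p : (ℝ → ℂ) × (ℝ → ℂ), WienerHopf.IsWHFactorization g p.1 p.2 ∧ p.1 0 = 1) ∧
    -- every factorization (however normalized) has the asserted form
    (∀ gm gp : ℝ → ℂ, WienerHopf.IsWHFactorization g gm gp →
      WienerHopf.InvertibleIn WienerHopf.Gminus (WienerHopf.tilde gp) ∧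
      (∀ t : ℝ, gm t = WienerHopf.xi g * (WienerHopf.tilde gp t)⁻¹) ∧
      (∀ t : ℝ, g t =
        (WienerHopf.xi g * (WienerHopf.tilde gp t)⁻¹) *
          Complex.exp (Complex.I * (WienerHopf.nu g : ℂ) * (t : ℂ)) *
          WienerHopf.chi t ^ WienerHopf.ind g * gp t)) := by
  open WienerHopf GAlg in
  obtain ⟨x, hx⟩ := mem_G_iff.1 hg
  have hmatch' : ∀ t, g t * g (-t) = 1 := fun t => congrFun hmatch t
  have hxx : x * reflect x = 1 := eval_injective fun t => by
    rw [eval_mul, eval_reflect, ← hx, ← hx, hmatch', eval_one]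
  obtain ⟨ν, n, β, κ, hβ, hκ, hn⟩ := exists_log hxx
  have hν := isNu_iff hx hxx hβ
  have hind := isN_iff hx hxx hκ hn
  have hνg : nu g = ν := (hν _).1 (Classical.epsilon_spec ⟨ν, (hν ν).2 rfl⟩)
  have hng : ind g = n := (hind _).1 (Classical.epsilon_spec ⟨n, (hind n).2 rfl⟩)
  rw [← hνg] at hβ hν
  rw [← hng] at hn hind
  refine ⟨hν, hind, ?_, ?_, fun gm gp h => ?_⟩
  · have h0 := hmatch' 0
    rw [neg_zero] at h0
    have h1 : ((-1 : ℂ) ^ ind g) * (-1) ^ ind g = 1 := by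
      rw [← mul_zpow, neg_one_mul, neg_neg, one_zpow]
    refine mul_self_eq_one_iff.1 ?_
    rw [xi]
    linear_combination (g 0 * g 0) * h1 + h0
  · obtain ⟨gm, gp, h, h0⟩ := exists_isWHFactorization hx hβ hn
    refine ⟨(gm, gp), ⟨h, h0⟩, ?_⟩
    rintro ⟨hm, hp⟩ ⟨h', h0'⟩
    obtain ⟨h1, h2⟩ := isWHFactorization_unique h' h h0' h0
    exact Prod.ext h1 h2
  · have h1 := isWHFactorization_minus_eq hmatch' h
    refine ⟨invertibleIn_Gminus_tilde h.2.1, h1, fun t => ?_⟩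
    rw [← h1]
    exact h.2.2 t
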